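/- Let $k$ be an algebraically closed field of characteristic zero and let $G$ be a linear algebraic group over $k$. A finite-dimensional linear representation $V$ of $G$ is called generically free if $G$ acts freely on a dense open subset of $V$. A rational map $F\colon V \dashrightarrow V$ is a canonical form map if $F(x) = f(x)\cdot x$ for some rational map $f\colon V \dashrightarrow G$ (where $f$ and $F$ need not be $G$-equivariant). Put $$\operatorname{cd}(V,G) = \min_F \{\dim F(V) - \dim (V/G)\},$$ where $F$ ranges over all canonical form maps $V \dashrightarrow V$ and $V/G$ is the rational quotient, so that $\dim(V/G) = \operatorname{trdeg}_k k(V)^G$. The canonical dimension $\operatorname{cd}(G)$ of $G$ is $\operatorname{cd}(V,G)$ for a generically free linear representation $V$ of $G$; this number does not depend on the choice of $V$. **Proposition.** For every integer $m \ge 1$ one has $$\operatorname{cd}(\operatorname{SO}_{2m}) \le \frac{m(m-1)}{2},$$ where $\operatorname{SO}_{2m} = \{A \in \operatorname{GL}_{2m} : A A^{T} = I,\ \det A = 1\}$ is the special orthogonal group over $k$. -/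

import Mathlib

open scoped Matrix

noncomputable section

/-- A linear algebraic group over `k` (to be used over an algebraically closed field of
characteristic zero, where such a group is determined by its `k`-points): a subgroup of
`GL_n(k)` which is Zariski closed in `GL_n(k)`. -/
structure LinAlgGroup (k : Type*) [Field k] (n : ℕ) where
  /-- The group of `k`-points. -/
  carrier : Subgroup (GL (Fin n) k)
  /-- The group is the zero set in `GL_n(k)` of some polynomials in the matrix entries. -/
  isClosed : ∃ S : Set (MvPolynomial (Fin n × Fin n) k), ∀ g : GL (Fin n) k,
    g ∈ carrier ↔ ∀ p ∈ S, MvPolynomial.eval (fun ij => g.1 ij.1 ij.2) p = 0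

namespace LinAlgGroup

variable {k : Type*} [Field k] {n : ℕ}

/-- The `L`-points of `G`, for a field extension `L / k`: the invertible matrices over `L`
satisfying all polynomial equations over `k` that hold on `G`. For `L = k(X)` the function field
of a variety `X`, this is the set of rational maps from `X` to `G`. -/
def points (G : LinAlgGroup k n) (L : Type*) [Field L] [Algebra k L] : Set (GL (Fin n) L) :=
  {g | ∀ p : MvPolynomial (Fin n × Fin n) k,
    (∀ h ∈ G.carrier, MvPolynomial.eval (fun ij => h.1 ij.1 ij.2) p = 0) →
      MvPolynomial.aeval (fun ij => g.1 ij.1 ij.2) p = 0}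

/-- A (finite-dimensional, algebraic) linear representation of `G` on `k ^ dim`: a homomorphism
from `G` to `GL_dim(k)` whose matrix entries are regular functions on `G`, that is, polynomials in
the entries of `g` divided by a power of `det g`. -/
structure Rep (G : LinAlgGroup k n) where
  /-- The dimension of the representation. -/
  dim : ℕ
  /-- The action on `k`-points. -/
  hom : G.carrier →* GL (Fin dim) k
  /-- Numerators of the matrix entries. -/
  num : Matrix (Fin dim) (Fin dim) (MvPolynomial (Fin n × Fin n) k)
  /-- The exponent of the determinant in the denominator. -/
  exponent : ℕ
  hom_apply : ∀ (g : G.carrier) (i j : Fin dim),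
    (hom g).1 i j =
      MvPolynomial.eval (fun ab => g.1.1 ab.1 ab.2) (num i j) / (g.1.1.det) ^ exponent

namespace Rep

variable {G : LinAlgGroup k n}

/-- The field `k(V)` of rational functions on the representation space `V`. -/
abbrev FunctionField (V : G.Rep) : Type _ := FractionRing (MvPolynomial (Fin V.dim) k)

/-- The `i`-th coordinate function on `V`. -/
def coord (V : G.Rep) (i : Fin V.dim) : V.FunctionField :=
  algebraMap (MvPolynomial (Fin V.dim) k) V.FunctionField (MvPolynomial.X i)

/-- `V` is generically free: `G` acts freely on a dense open subset of `V` (which may be taken to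
be the locus where some nonzero polynomial does not vanish). -/
def IsGenericallyFree (V : G.Rep) : Prop :=
  ∃ p : MvPolynomial (Fin V.dim) k, p ≠ 0 ∧ ∀ x : Fin V.dim → k, MvPolynomial.eval x p ≠ 0 →
    ∀ g : G.carrier, (V.hom g).1 *ᵥ x = x → g = 1

/-- The matrix in `M_dim(L)` by which an `L`-point of `G` acts on `L ^ dim`. On `L`-points it does
not depend on the choice of numerators and exponent. -/
def actionMatrix (V : G.Rep) {L : Type*} [Field L] [Algebra k L] (g : GL (Fin n) L) :
    Matrix (Fin V.dim) (Fin V.dim) L :=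
  Matrix.of fun i j =>
    MvPolynomial.aeval (fun ab => g.1 ab.1 ab.2) (V.num i j) / (g.1.det) ^ V.exponent

/-- The linear substitution `p(x) ↦ p(A x)` on polynomials. -/
def linSubst {N : ℕ} (A : Matrix (Fin N) (Fin N) k) :
    MvPolynomial (Fin N) k →ₐ[k] MvPolynomial (Fin N) k :=
  MvPolynomial.aeval fun i => ∑ j, MvPolynomial.C (A i j) * MvPolynomial.X j

theorem linSubst_comp {N : ℕ} (A B : Matrix (Fin N) (Fin N) k) :
    (linSubst A).comp (linSubst B) = linSubst (B * A) := by
  apply MvPolynomial.algHom_ext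
  intro i
  simp only [linSubst, AlgHom.comp_apply, MvPolynomial.aeval_X, map_sum, map_mul,
    MvPolynomial.algHom_C, MvPolynomial.algebraMap_eq, Matrix.mul_apply, Finset.mul_sum,
    Finset.sum_mul]
  rw [Finset.sum_comm]
  simp only [mul_assoc]

theorem linSubst_one {N : ℕ} :
    linSubst (1 : Matrix (Fin N) (Fin N) k) = AlgHom.id k (MvPolynomial (Fin N) k) := by
  apply MvPolynomial.algHom_ext
  intro i
  simp [linSubst, Matrix.one_apply]

/-- The automorphism `φ(x) ↦ φ(g x)` of the polynomial ring `k[V]`. -/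
def polyAut (V : G.Rep) (g : G.carrier) :
    MvPolynomial (Fin V.dim) k ≃ₐ[k] MvPolynomial (Fin V.dim) k :=
  AlgEquiv.ofAlgHom (linSubst (V.hom g).1) (linSubst (V.hom g)⁻¹.1)
    (by rw [linSubst_comp, Units.inv_mul, linSubst_one])
    (by rw [linSubst_comp, Units.mul_inv, linSubst_one])

/-- The automorphism `φ(x) ↦ φ(g x)` of the field `k(V)`. -/
def fieldAut (V : G.Rep) (g : G.carrier) : V.FunctionField ≃+* V.FunctionField :=
  IsFractionRing.ringEquivOfRingEquiv (V.polyAut g).toRingEquiv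

theorem fieldAut_algebraMap (V : G.Rep) (g : G.carrier) (p : MvPolynomial (Fin V.dim) k) :
    V.fieldAut g (algebraMap _ V.FunctionField p) =
      algebraMap _ V.FunctionField (linSubst (V.hom g).1 p) := by
  simp [fieldAut, polyAut]

/-- The field `k(V)^G` of invariant rational functions, i.e. the function field of the rational
quotient `V/G`. -/
def invariantField (V : G.Rep) : IntermediateField k V.FunctionField where
  carrier := {φ | ∀ g : G.carrier, V.fieldAut g φ = φ}
  mul_mem' := fun ha hb g => by rw [map_mul, ha g, hb g]
  add_mem' := fun ha hb g => by rw [map_add, ha g, hb g]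
  inv_mem' := fun _ ha g => by rw [map_inv₀, ha g]
  algebraMap_mem' := fun c g => by
    rw [IsScalarTower.algebraMap_apply k (MvPolynomial (Fin V.dim) k) V.FunctionField,
      fieldAut_algebraMap, AlgHom.commutes]

/-- `dim (V/G)`, the transcendence degree of `k(V)^G` over `k`. -/
def dimQuotient (V : G.Rep) : ℕ := Cardinal.toNat (Algebra.trdeg k V.invariantField)

/-- The coordinates in `k(V)` of the canonical form map `F(x) = f(x) · x` induced by a rational map
`f` from `V` to `G`. -/
def canonicalForm (V : G.Rep) (f : GL (Fin n) V.FunctionField) : Fin V.dim → V.FunctionField :=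
  V.actionMatrix f *ᵥ V.coord

/-- `dim F(V)` for a rational map `F` from `V` to `V`, i.e. the transcendence degree over `k` of
the field generated by the coordinates of `F` (the function field of the closure of `F(V)`). -/
def dimImage (V : G.Rep) (F : Fin V.dim → V.FunctionField) : ℕ :=
  Cardinal.toNat (Algebra.trdeg k (IntermediateField.adjoin k (Set.range F)))

/-- The canonical dimension `cd(V, G) = min {dim F(V) - dim (V/G)}`, the minimum being taken over
all canonical form maps `F`. -/
def canonicalDim (V : G.Rep) : ℤ :=
  sInf {d : ℤ | ∃ f ∈ G.points V.FunctionField,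
    d = (V.dimImage (V.canonicalForm f) : ℤ) - (V.dimQuotient : ℤ)}

end Rep

/-- `G` acting on `M_n(k) = k ^ (n * n)` by left multiplication. -/
def leftMul (G : LinAlgGroup k n) : G.Rep where
  dim := n * n
  hom :=
    { toFun := fun g =>
        Units.map (Matrix.reindexAlgEquiv k k finProdFinEquiv).toMonoidHom
          (Units.map
            { toFun := fun A : Matrix (Fin n) (Fin n) k =>
                Matrix.kroneckerMap (· * ·) A (1 : Matrix (Fin n) (Fin n) k)
              map_one' := Matrix.one_kronecker_one
              map_mul' := fun A B => by
                rw [← Matrix.mul_kronecker_mul, one_mul] } g.1)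
      map_one' := by simp
      map_mul' := fun a b => by simp only [Subgroup.coe_mul, map_mul] }
  num := Matrix.of fun i j =>
    if (finProdFinEquiv.symm i).2 = (finProdFinEquiv.symm j).2 then
      MvPolynomial.X ((finProdFinEquiv.symm i).1, (finProdFinEquiv.symm j).1) else 0
  exponent := 0
  hom_apply := fun g i j => by
    by_cases h : i.modNat = j.modNat <;> simp [h]

/-- Generically free linear representations exist, so that the supremum defining `cd(G)` below is
never taken over the empty family. -/
theorem isGenericallyFree_leftMul (G : LinAlgGroup k n) : G.leftMul.IsGenericallyFree := by
  classical
  let e : Fin n × Fin n ≃ Fin (n * n) := finProdFinEquiv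
  let P : Matrix (Fin n) (Fin n) (MvPolynomial (Fin (n * n)) k) :=
    Matrix.of fun i j => MvPolynomial.X (e (i, j))
  have heval : ∀ x : Fin (n * n) → k, MvPolynomial.eval x P.det =
      (Matrix.of fun i j => x (e (i, j)) : Matrix (Fin n) (Fin n) k).det := by
    intro x
    rw [RingHom.map_det]
    congr 1
    ext i j
    simp [P]
  refine ⟨P.det, ?_, ?_⟩
  · intro h
    change P.det = 0 at h
    have h1 := heval fun a => if (e.symm a).1 = (e.symm a).2 then 1 else 0
    have h2 : (Matrix.of fun i j : Fin n => if (e.symm (e (i, j))).1 = (e.symm (e (i, j))).2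
        then (1 : k) else 0) = (1 : Matrix (Fin n) (Fin n) k) := by
      ext i j
      simp [Matrix.one_apply]
    rw [h2, h, Matrix.det_one, map_zero] at h1
    exact zero_ne_one h1
  · intro x hx g hg
    change Fin (n * n) → k at x
    change MvPolynomial.eval x P.det ≠ 0 at hx
    rw [heval] at hx
    set A : Matrix (Fin n) (Fin n) k := Matrix.of fun i j => x (e (i, j)) with hA
    have hmul : g.1.1 * A = A := by
      ext i j
      have h3 := congrFun hg (e (i, j))
      have h4 : ∑ a : Fin (n * n), (G.leftMul.hom g).1 (e (i, j)) a * x a = x (e (i, j)) := h3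
      rw [← Equiv.sum_comp e, Fintype.sum_prod_type] at h4
      have h5 : ∀ a b : Fin n, (G.leftMul.hom g).1 (e (i, j)) (e (a, b)) =
          g.1.1 i a * (1 : Matrix (Fin n) (Fin n) k) j b := fun a b => by
        change Matrix.kroneckerMap (· * ·) g.1.1 (1 : Matrix (Fin n) (Fin n) k)
          (e.symm (e (i, j))) (e.symm (e (a, b))) = _
        simp
      simp only [h5] at h4
      simpa [Matrix.mul_apply, Matrix.one_apply, hA] using h4
    have hu : IsUnit A := (Matrix.isUnit_iff_isUnit_det A).2 (isUnit_iff_ne_zero.2 hx)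
    have h5 : g.1.1 = 1 := hu.mul_right_cancel (by rw [hmul, one_mul])
    exact Subtype.ext (Units.ext h5)

/-- The canonical dimension `cd(G)` of a linear algebraic group, i.e. `cd(V, G)` for a generically
free linear representation `V`. The number `cd(V, G)` is independent of the choice of `V`; here
`cd(G)` is defined, without appeal to that fact, as the supremum over all choices. -/
def canonicalDim (G : LinAlgGroup k n) : EReal :=
  ⨆ V : G.Rep, ⨆ _ : V.IsGenericallyFree, (((V.canonicalDim : ℤ) : ℝ) : EReal)

end LinAlgGroup

/-- The special orthogonal group `SO_n` over `k`, as a linear algebraic group. -/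
def specialOrthogonal (k : Type*) [Field k] (n : ℕ) : LinAlgGroup k n where
  carrier :=
    { carrier := {g | g.1 ∈ Matrix.specialOrthogonalGroup (Fin n) k}
      mul_mem' := fun {a b} ha hb =>
        (mul_mem (S := Submonoid (Matrix (Fin n) (Fin n) k)) ha hb :
          a.1 * b.1 ∈ Matrix.specialOrthogonalGroup (Fin n) k)
      one_mem' := one_mem (Matrix.specialOrthogonalGroup (Fin n) k)
      inv_mem' := fun {g} hg => by
        have h := Matrix.mem_specialOrthogonalGroup_iff.1 hg
        have h1 : g⁻¹.1 = g.1ᵀ := by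
          rw [Matrix.coe_units_inv]
          exact Matrix.inv_eq_right_inv ((Matrix.mem_orthogonalGroup_iff _ _).1 h.1)
        change g⁻¹.1 ∈ Matrix.specialOrthogonalGroup (Fin n) k
        rw [h1, Matrix.mem_specialOrthogonalGroup_iff, Matrix.mem_orthogonalGroup_iff,
          Matrix.transpose_transpose, Matrix.det_transpose]
        exact ⟨(Matrix.mem_orthogonalGroup_iff' _ _).1 h.1, h.2⟩ }
  isClosed := by
    refine ⟨insert ((Matrix.of fun i j => (MvPolynomial.X (i, j) :
        MvPolynomial (Fin n × Fin n) k)).det - 1)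
      (Set.range fun ab : Fin n × Fin n =>
        ∑ j, MvPolynomial.X (ab.1, j) * MvPolynomial.X (ab.2, j) -
          MvPolynomial.C ((1 : Matrix (Fin n) (Fin n) k) ab.1 ab.2)), fun g => ?_⟩
    have hdet : MvPolynomial.eval (fun ij : Fin n × Fin n => g.1 ij.1 ij.2)
        ((Matrix.of fun i j => (MvPolynomial.X (i, j) :
          MvPolynomial (Fin n × Fin n) k)).det - 1) = g.1.det - 1 := by
      rw [map_sub, map_one, RingHom.map_det]
      congr 2
      ext i j
      simp
    rw [Set.forall_mem_insert, hdet, Set.forall_mem_range]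
    change g.1 ∈ Matrix.specialOrthogonalGroup (Fin n) k ↔ _
    rw [Matrix.mem_specialOrthogonalGroup_iff, Matrix.mem_orthogonalGroup_iff, sub_eq_zero,
      and_comm, ← Matrix.ext_iff]
    simp [Matrix.mul_apply, sub_eq_zero]

end

universe u

/-! Let G be the special orthogonal group, L = k(V), K = k(V)^G, and σ_g the automorphism φ(x) ↦
φ(gx) of L. Generic freeness makes the generic point of V a G-torsor over K that becomes trivial
over L. For an orthogonal group this amounts to a quadratic form: there is an invertible ψ over L
with σ_g ψ = gψ and ψᵀψ diagonal with entries in K (`exists_covariant_orthogonal_frame`). The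
coordinates of the generic point are polynomials over K in the entries of ψ
(`exists_coord_eq_polynomial`), and moving the point by f ∈ G(L) replaces ψ by fψ in them
(`canonicalForm_eq_polynomial`). So it suffices to bring fψ into a small field E containing K.

Over L the form ψᵀψ is a sum of 2m squares, so it has a totally isotropic subspace of dimension m.
Let E be K with the chart coordinates of this subspace adjoined. Such subspaces depend on m(m-1)/2
parameters, the entries of a skew matrix (`trdeg_isotropic_chart_le`). Over E the form is
hyperbolic, hence a sum of squares, so some h over E makes ψh orthogonal
(`exists_orthogonal_reduction`). With f = (ψh)ᵀ one gets fψ = hᵀψᵀψ over E, and dim F(V) ≤ trdeg E ≤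
dim V/G + m(m-1)/2.

The frame ψ comes from `entryFun_mem_span`: the matrix entries, as L-valued functions on G, lie in
the L-span of the functions g ↦ σ_g b, the image of L ⊗_K L. Freeness and characteristic zero make
them rational functions of the orbit coordinates (`exists_denominator`); this uses irreducibility of
G, so that the regular functions over L form a domain. The denominators disappear because the
conductor is stable under G. -/

/-! ### Nullstellensatz with values in reduced rings -/

/-- By the Nullstellensatz a power of `p` lies in the ideal generated by `S`, and a reduced ring
ignores the exponent. -/
theorem aeval_eq_zero_of_vanishes {k : Type*} [Field k] [IsAlgClosed k] {ι : Type*} [Finite ι]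
    (S : Set (MvPolynomial ι k)) (p : MvPolynomial ι k)
    (h : ∀ z : ι → k, (∀ s ∈ S, MvPolynomial.eval z s = 0) → MvPolynomial.eval z p = 0)
    {T : Type*} [CommRing T] [Algebra k T] [IsReduced T] (z : ι → T)
    (hz : ∀ s ∈ S, MvPolynomial.aeval z s = 0) : MvPolynomial.aeval z p = 0 := by
  have h1 : p ∈ MvPolynomial.vanishingIdeal k (MvPolynomial.zeroLocus k (Ideal.span S)) := by
    intro w hw
    rw [MvPolynomial.zeroLocus_span] at hw
    simpa [MvPolynomial.coe_aeval_eq_eval] using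
      h w (fun s hs => by simpa [MvPolynomial.coe_aeval_eq_eval] using hw s hs)
  rw [MvPolynomial.vanishingIdeal_zeroLocus_eq_radical] at h1
  obtain ⟨r, hr⟩ := h1
  have h2 : Ideal.span S ≤ RingHom.ker (MvPolynomial.aeval (R := k) z) :=
    Ideal.span_le.2 fun s hs => hz s hs
  have h3 := h2 hr
  rw [RingHom.mem_ker, map_pow] at h3
  exact eq_zero_of_pow_eq_zero h3

/-! ### Descent for a group of field automorphisms -/

section Descent

variable {Γ : Type*} [Group Γ] {L : Type*} [Field L]

/-- The function `g ↦ σ_g b` attached to an element `b` of a field with operators `σ`. -/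
def orb (σ : Γ → L ≃+* L) : L →+* (Γ → L) := RingHom.pi fun g => (σ g : L →+* L)

omit [Group Γ] in
theorem orb_apply (σ : Γ → L ≃+* L) (b : L) (g : Γ) : orb σ b g = σ g b := rfl

/-- The semilinear action of `h` on functions which fixes all functions `orb σ b`. -/
def twist (σ : Γ → L ≃+* L) (h : Γ) : (Γ → L) →+* (Γ → L) where
  toFun ψ g := σ h (ψ (g * h⁻¹))
  map_one' := by ext; simp
  map_mul' _ _ := by ext; simp
  map_zero' := by ext; simp
  map_add' _ _ := by ext; simp

theorem twist_apply (σ : Γ → L ≃+* L) (h : Γ) (ψ : Γ → L) (g : Γ) :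
    twist σ h ψ g = σ h (ψ (g * h⁻¹)) := rfl

variable (σ : Γ → L ≃+* L)

theorem twist_smul (h : Γ) (a : L) (ψ : Γ → L) :
    twist σ h (a • ψ) = σ h a • twist σ h ψ := by
  ext g; simp [twist_apply]

variable (hσ : ∀ g h a, σ h (σ g a) = σ (g * h) a)
include hσ

theorem operator_one (a : L) : σ 1 a = a := by
  apply (σ 1).injective
  rw [hσ, one_mul]

theorem twist_orb (h : Γ) (b : L) : twist σ h (orb σ b) = orb σ b := by
  ext g
  rw [twist_apply, orb_apply, orb_apply, hσ, inv_mul_cancel_right]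

omit hσ in
theorem eq_orb_of_twist_eq {ψ : Γ → L} (h : ∀ g, twist σ g ψ = ψ) : ψ = orb σ (ψ 1) := by
  ext g
  have h1 := congrFun (h g) g
  rw [twist_apply, mul_inv_cancel] at h1
  exact h1.symm

theorem twist_twist_inv (h : Γ) (ψ : Γ → L) : twist σ h (twist σ h⁻¹ ψ) = ψ := by
  ext g
  simp [twist_apply, hσ, operator_one σ hσ]

theorem twist_linearCombination (B : Set (Γ → L)) (hB : B ⊆ Set.range (orb σ)) (h : Γ)
    (l : B →₀ L) : twist σ h (Finsupp.linearCombination L (fun b : B => (b : Γ → L)) l) =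
      Finsupp.linearCombination L (fun b : B => (b : Γ → L))
        (l.mapRange (σ h) (map_zero (σ h))) := by
  rw [Finsupp.linearCombination_apply, Finsupp.linearCombination_apply, Finsupp.sum, map_sum,
    Finsupp.sum_mapRange_index (by simp), Finsupp.sum]
  refine Finset.sum_congr rfl fun b _ => ?_
  obtain ⟨c, hc⟩ := hB b.2
  rw [twist_smul, ← hc, twist_orb σ hσ]

theorem twist_mem_span (h : Γ) {ψ : Γ → L} (hψ : ψ ∈ Submodule.span L (Set.range (orb σ))) :
    twist σ h ψ ∈ Submodule.span L (Set.range (orb σ)) := by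
  induction hψ using Submodule.span_induction with
  | mem x hx =>
    obtain ⟨b, rfl⟩ := hx
    rw [twist_orb σ hσ]
    exact Submodule.subset_span ⟨b, rfl⟩
  | zero => rw [map_zero]; exact zero_mem _
  | add x y _ _ hx hy => rw [map_add]; exact add_mem hx hy
  | smul a x _ hx => rw [twist_smul]; exact Submodule.smul_mem _ _ hx

/-- Artin's argument: take an element of `J` with the fewest nonzero coefficients in a basis of
`orb` functions, one of them scaled to 1. Its difference with a twist is shorter, hence zero; and a
function fixed by all twists is an `orb`. -/
theorem exists_orb_mem_of_twist_stable (J : Submodule L (Γ → L))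
    (hJ : J ≤ Submodule.span L (Set.range (orb σ)))
    (hst : ∀ h, ∀ ψ ∈ J, twist σ h ψ ∈ J) {c : Γ → L} (hc : c ∈ J) (hc0 : c ≠ 0) :
    ∃ b : L, b ≠ 0 ∧ orb σ b ∈ J := by
  classical
  obtain ⟨B, hB, hsp, hli⟩ := exists_linearIndependent L (Set.range (orb σ))
  set lc := Finsupp.linearCombination L (fun b : B => (b : Γ → L)) with hlc
  have hinj : Function.Injective lc := hli
  have hex : ∃ r : ℕ, ∃ l : B →₀ L, l ≠ 0 ∧ lc l ∈ J ∧ l.support.card = r := by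
    have h1 := hJ hc
    rw [← hsp, ← Subtype.range_coe (s := B), Finsupp.mem_span_range_iff_exists_finsupp] at h1
    obtain ⟨l, hl⟩ := h1
    have h2 : lc l = c := by rw [hlc, Finsupp.linearCombination_apply]; exact hl
    refine ⟨_, l, ?_, h2 ▸ hc, rfl⟩
    rintro rfl
    exact hc0 (by rw [← h2, map_zero])
  obtain ⟨l0, hl0, hl0J, hcard⟩ := Nat.find_spec hex
  have hmin := fun r hr => Nat.find_min hex (m := r) hr
  rw [← hcard] at hmin
  obtain ⟨t, ht⟩ := Finsupp.support_nonempty_iff.2 hl0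
  have ht0 : l0 t ≠ 0 := Finsupp.mem_support_iff.1 ht
  set l := (l0 t)⁻¹ • l0 with hl
  have hlJ : lc l ∈ J := by rw [hl, map_smul]; exact J.smul_mem _ hl0J
  have hlt : l t = 1 := by simp [hl, ht0]
  have hinv : ∀ h, twist σ h (lc l) = lc l := by
    intro h
    have h1 : lc (l.mapRange (σ h) (map_zero (σ h)) - l) ∈ J := by
      rw [map_sub, hlc, ← twist_linearCombination σ hσ B hB]
      exact J.sub_mem (hst _ _ hlJ) hlJ
    by_contra hne
    have h2 : l.mapRange (σ h) (map_zero (σ h)) - l ≠ 0 := by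
      intro h3
      apply hne
      rw [hlc, twist_linearCombination σ hσ B hB, sub_eq_zero.1 h3]
    refine hmin _ (Finset.card_lt_card (Finset.ssubset_iff_subset_ne.2 ⟨?_, ?_⟩)) ⟨_, h2, h1, rfl⟩
    · intro s hs
      rw [Finsupp.mem_support_iff] at hs ⊢
      intro h0
      apply hs
      simp [hl, h0]
    · intro heq
      rw [← heq, Finsupp.mem_support_iff] at ht
      apply ht
      simp [hlt]
  have h1 := eq_orb_of_twist_eq σ hinv
  refine ⟨lc l 1, ?_, h1 ▸ hlJ⟩
  intro h0
  rw [h0, map_zero] at h1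
  have : l = 0 := hinj (by rw [h1, map_zero])
  rw [this] at hlt
  simp at hlt

/-- Twists fix all `orb` functions, so by uniqueness the coefficients in an independent family of
them are invariant, that is, in `K`. Evaluation at the identity then gives the relation in `L`. -/
theorem mem_span_of_orb_mem_span (K : Subfield L) (hK : ∀ a, a ∈ K ↔ ∀ g, σ g a = a) (s : Set L)
    (b : L) (hb : orb σ b ∈ Submodule.span L (orb σ '' s)) : b ∈ Submodule.span K s := by
  obtain ⟨B, hB, hsp, hli⟩ := exists_linearIndependent L (orb σ '' s)
  have hB' : B ⊆ Set.range (orb σ) := hB.trans (Set.image_subset_range _ _)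
  rw [← hsp, ← Subtype.range_coe (s := B), Finsupp.mem_span_range_iff_exists_finsupp] at hb
  obtain ⟨l, hl⟩ := hb
  rw [← Finsupp.linearCombination_apply] at hl
  have hinv : ∀ h t, σ h (l t) = l t := by
    intro h t
    have h1 := twist_linearCombination σ hσ B hB' h l
    rw [hl, twist_orb σ hσ, ← hl] at h1
    exact (DFunLike.congr_fun (hli h1) t).symm
  have h2 := congrFun hl 1
  rw [orb_apply, operator_one σ hσ, Finsupp.linearCombination_apply, Finsupp.sum,
    Finset.sum_apply] at h2
  rw [← h2]
  refine Submodule.sum_mem _ fun t _ => ?_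
  obtain ⟨c, hc, hct⟩ := hB t.2
  rw [Pi.smul_apply, ← hct, orb_apply, operator_one σ hσ]
  exact Submodule.smul_mem _ (⟨l t, (hK _).2 fun h => hinv h t⟩ : K) (Submodule.subset_span hc)

/-- This plays the role of Hilbert 90. Expanding the functions g ↦ ρ(g)_ij in a basis of `orb`
functions gives, for each i and each basis element, a row vector of coefficients with the required
covariance; n independent ones among them form `φ`. -/
theorem exists_covariant_matrix {k : Type*} [Field k] [Algebra k L] {n : ℕ}
    (ρ : Γ →* Matrix (Fin n) (Fin n) k) (hk : ∀ g (c : k), σ g (algebraMap k L c) = algebraMap k L c)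
    (hspan : ∀ i j, (fun g => algebraMap k L (ρ g i j)) ∈ Submodule.span L (Set.range (orb σ))) :
    ∃ φ : Matrix (Fin n) (Fin n) L, IsUnit φ ∧
      ∀ g, φ.map (σ g) = φ * (ρ g⁻¹).map (algebraMap k L) := by
  classical
  obtain ⟨B, hB, hsp, hli⟩ := exists_linearIndependent L (Set.range (orb σ))
  have hex : ∀ i j, ∃ l : B →₀ L, Finsupp.linearCombination L (fun b : B => (b : Γ → L)) l =
      fun g => algebraMap k L (ρ g i j) := by
    intro i j
    have h1 := hspan i j
    rw [← hsp, ← Subtype.range_coe (s := B), Finsupp.mem_span_range_iff_exists_finsupp] at h1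
    obtain ⟨l, hl⟩ := h1
    exact ⟨l, by rw [Finsupp.linearCombination_apply]; exact hl⟩
  choose l hl using hex
  -- The twist by h turns ρ(g)_ij into ρ(g h⁻¹)_ij, which is expanded as a matrix product; then
  -- coefficients are compared.
  have hcov : ∀ h i j t, σ h (l i j t) = ∑ a, l i a t * algebraMap k L (ρ h⁻¹ a j) := by
    intro h i j t
    have h1 : Finsupp.linearCombination L (fun b : B => (b : Γ → L))
        ((l i j).mapRange (σ h) (map_zero (σ h))) =
        Finsupp.linearCombination L (fun b : B => (b : Γ → L))
          (∑ a, algebraMap k L (ρ h⁻¹ a j) • l i a) := by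
      rw [← twist_linearCombination σ hσ B hB, hl, map_sum]
      ext g
      simp only [map_smul, hl, twist_apply, map_mul, hk, Matrix.mul_apply, map_sum,
        Finset.sum_apply, Pi.smul_apply, smul_eq_mul]
      exact Finset.sum_congr rfl fun _ _ => mul_comm _ _
    have h2 := DFunLike.congr_fun (hli h1) t
    simp only [Finsupp.mapRange_apply, Finsupp.coe_finsetSum, Finset.sum_apply, Finsupp.smul_apply,
      smul_eq_mul] at h2
    rw [h2]
    exact Finset.sum_congr rfl fun _ _ => mul_comm _ _
  set S : Set (Fin n → L) := Set.range fun p : Fin n × B => fun j => l p.1 j p.2 with hS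
  -- At the identity of the group ρ is the unit matrix, so the expansions there express each
  -- standard basis vector through the rows.
  have htop : ⊤ ≤ Submodule.span L S := by
    rw [← (Pi.basisFun L (Fin n)).span_eq, Submodule.span_le]
    rintro _ ⟨i, rfl⟩
    have h1 : ∀ j, ∑ t ∈ Finset.univ.biUnion (fun j => (l i j).support), (t : Γ → L) 1 * l i j t =
        Pi.basisFun L (Fin n) i j := by
      intro j
      have h2 := congrFun (hl i j) 1
      rw [Finsupp.linearCombination_apply, Finsupp.sum_of_support_subset _
        (Finset.subset_biUnion_of_mem (fun j => (l i j).support) (Finset.mem_univ j)) _ (by simp),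
        Finset.sum_apply] at h2
      simp only [Pi.smul_apply, smul_eq_mul, map_one] at h2
      rw [Finset.sum_congr rfl fun t _ => mul_comm _ _, h2]
      simp [Matrix.one_apply, Pi.single_apply, apply_ite, eq_comm]
    have h3 : Pi.basisFun L (Fin n) i = ∑ t ∈ Finset.univ.biUnion (fun j => (l i j).support),
        (t : Γ → L) 1 • fun j => l i j t := by
      ext j
      rw [← h1 j, Finset.sum_apply]
      rfl
    rw [h3]
    exact Submodule.sum_mem _ fun t _ => Submodule.smul_mem _ _ (Submodule.subset_span ⟨(i, t), rfl⟩)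
  let b := Module.Basis.ofSpan htop
  let e : Fin n ≃ _ := (Pi.basisFun L (Fin n)).indexEquiv b
  refine ⟨Matrix.of fun i => b (e i), ?_, ?_⟩
  · rw [← Matrix.linearIndependent_rows_iff_isUnit]
    exact b.linearIndependent.comp _ e.injective
  · intro g
    ext i j
    have h1 : b (e i) ∈ S := Module.Basis.ofSpan_subset htop ⟨e i, rfl⟩
    obtain ⟨⟨a, t⟩, h2⟩ := h1
    simp only [Matrix.map_apply, Matrix.of_apply, Matrix.mul_apply]
    rw [← h2]
    exact hcov g a j t

end Descent

/-! ### Elements of a subfield detected by pairs of ring maps -/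

-- Any two `M`-algebra maps to a reduced ring, from an algebra inside `F` containing `a`, must agree
-- on `a`. If `a` were transcendental, X ↦ 1 and X ↦ 0 would violate this; if algebraic, all its
-- conjugates coincide, and separability forces degree one.
open TensorProduct in
theorem mem_range_of_isNilpotent_tmul_sub {M F : Type u} [Field M] [CharZero M] [Field F]
    [Algebra M F] {a : F} (ha : IsNilpotent (a ⊗ₜ[M] 1 - 1 ⊗ₜ[M] a : F ⊗[M] F)) :
    a ∈ (algebraMap M F).range := by
  have key : ∀ (N T : Type u) [CommRing N] [CommRing T] [Algebra M N] [Algebra M T] [IsReduced T]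
      (f : N →ₐ[M] F) (_ : Function.Injective f) (x : N) (_ : f x = a) (u v : N →ₐ[M] T),
      u x = v x := by
    intro N T _ _ _ _ _ f hf x hx u v
    -- Flatness over a field embeds N ⊗ N in F ⊗ F, so nilpotence may be tested in the latter.
    have hinj : Function.Injective (Algebra.TensorProduct.map f f) :=
      TensorProduct.map_injective_of_flat_flat f.toLinearMap f.toLinearMap hf hf
    have h1 : IsNilpotent (x ⊗ₜ[M] 1 - 1 ⊗ₜ[M] x : N ⊗[M] N) := by
      rw [← IsNilpotent.map_iff hinj]
      simpa [hx] using ha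
    have h2 := h1.map (Algebra.TensorProduct.lift u v fun _ _ => Commute.all _ _)
    simp only [map_sub, Algebra.TensorProduct.lift_tmul, map_one, mul_one, one_mul] at h2
    exact sub_eq_zero.1 h2.eq_zero
  have hint : IsIntegral M a := by
    rw [← isAlgebraic_iff_isIntegral]
    by_contra htr
    have h1 := key (Polynomial M) M (Polynomial.aeval a)
      (transcendental_iff_injective.1 htr) Polynomial.X (by simp)
      (Polynomial.aeval 1) (Polynomial.aeval 0)
    simp at h1
  have hroots : ((minpoly M a).rootSet (AlgebraicClosure M)).Subsingleton := by
    intro b hb c hc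
    rw [Polynomial.mem_rootSet] at hb hc
    let pb := IntermediateField.adjoin.powerBasis hint
    have hmin : minpoly M pb.gen = minpoly M a := by
      rw [IntermediateField.adjoin.powerBasis_gen, IntermediateField.minpoly_gen]
    have h1 := key (IntermediateField.adjoin M {a}) (AlgebraicClosure M)
      (IntermediateField.adjoin M {a}).val Subtype.val_injective pb.gen
      (by rw [IntermediateField.adjoin.powerBasis_gen]; rfl)
      (pb.lift b (by rw [hmin]; exact hb.2)) (pb.lift c (by rw [hmin]; exact hc.2))
    simpa using h1
  rw [← minpoly.natDegree_eq_one_iff]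
  have hcard := Polynomial.card_rootSet_eq_natDegree (K := AlgebraicClosure M)
    (minpoly.irreducible hint).separable (IsAlgClosed.splits _)
  have := Fintype.card_le_one_iff_subsingleton.2 hroots.coe_sort
  have := minpoly.natDegree_pos hint
  omega

-- Some prime of F ⊗ F avoids the non-nilpotent element a ⊗ 1 - 1 ⊗ a; the two inclusions of `F` are
-- compared in the quotient.
open TensorProduct in
theorem exists_ringHom_ne_of_notMem_range {M F : Type u} [Field M] [CharZero M] [Field F]
    [Algebra M F] {a : F} (ha : a ∉ (algebraMap M F).range) :
    ∃ (T : Type u) (_ : CommRing T) (_ : IsReduced T) (u v : F →+* T),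
      (∀ c, u (algebraMap M F c) = v (algebraMap M F c)) ∧ u a ≠ v a := by
  have hnil := mt mem_range_of_isNilpotent_tmul_sub ha
  rw [nilpotent_iff_mem_prime] at hnil
  push Not at hnil
  obtain ⟨P, hP, hδ⟩ := hnil
  refine ⟨(F ⊗[M] F) ⧸ P, inferInstance, inferInstance, (Ideal.Quotient.mk P).comp
    (Algebra.TensorProduct.includeLeft : F →ₐ[M] F ⊗[M] F).toRingHom, (Ideal.Quotient.mk P).comp
    (Algebra.TensorProduct.includeRight : F →ₐ[M] F ⊗[M] F).toRingHom, fun c => ?_, fun h => hδ ?_⟩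
  · change Ideal.Quotient.mk P (algebraMap M F c ⊗ₜ[M] 1) =
      Ideal.Quotient.mk P (1 ⊗ₜ[M] algebraMap M F c)
    rw [Algebra.algebraMap_eq_smul_one, TensorProduct.smul_tmul]
  · rw [← Ideal.Quotient.eq_zero_iff_mem, map_sub, sub_eq_zero]
    exact h

/-! ### Cayley transform and its sign-changed charts -/

section Cayley

variable {ι : Type*} [Fintype ι] [DecidableEq ι]

/-- The diagonal matrix with entries `-1` at the places in `s` and `1` elsewhere. -/
def signDiag (R : Type*) [CommRing R] (s : Finset ι) : Matrix ι ι R :=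
  Matrix.diagonal fun i => if i ∈ s then -1 else 1

theorem signDiag_mul_self (R : Type*) [CommRing R] (s : Finset ι) :
    signDiag R s * signDiag R s = 1 := by
  rw [signDiag, Matrix.diagonal_mul_diagonal, ← Matrix.diagonal_one]
  congr 1
  ext i
  split_ifs <;> simp

omit [Fintype ι] in
theorem signDiag_transpose (R : Type*) [CommRing R] (s : Finset ι) :
    (signDiag R s)ᵀ = signDiag R s := Matrix.diagonal_transpose _

theorem det_signDiag (R : Type*) [CommRing R] (s : Finset ι) :
    (signDiag R s).det = (-1) ^ s.card := by
  simp [signDiag, Matrix.det_diagonal]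

/-- The determinant is affine in each diagonal entry, so each entry can in turn be moved to -1 or 1
while it stays nonzero. The start is a scalar matrix whose scalar is not an eigenvalue of `-g`. Thus
the sign-changed Cayley charts cover the orthogonal group. -/
theorem exists_det_signDiag_add_ne_zero {F : Type*} [Field F] [CharZero F] (g : Matrix ι ι F) :
    ∃ s : Finset ι, (signDiag F s + g).det ≠ 0 := by
  have haff : ∀ (ε : ι → F) (i : ι), ∃ a b : F, ∀ t,
      (Matrix.diagonal (Function.update ε i t) + g).det = a + t * b := by
    intro ε i
    refine ⟨((Matrix.diagonal ε + g).updateRow i (g i)).det,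
      ((Matrix.diagonal ε + g).updateRow i (Pi.single i 1)).det, fun t => ?_⟩
    rw [← Matrix.det_updateRow_smul, ← Matrix.det_updateRow_add]
    congr 1
    ext a b
    by_cases h : a = i
    · subst h
      by_cases hb : b = a
      · subst hb; simp [add_comm]
      · simp [Matrix.diagonal_apply_ne' _ hb, hb]
    · by_cases hb : a = b
      · subst hb; simp [h]
      · simp [Matrix.updateRow_ne h, Matrix.diagonal_apply_ne _ hb]
  have hstart : ∃ ε : ι → F, (Matrix.diagonal ε + g).det ≠ 0 := by
    obtain ⟨t, ht⟩ := Polynomial.exists_eval_ne_zero_of_natDegree_lt_card (-g).charpoly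
      (Matrix.charpoly_monic _).ne_zero
      (lt_of_lt_of_le (Cardinal.natCast_lt_aleph0) (Cardinal.aleph0_le_mk F))
    refine ⟨fun _ => t, ?_⟩
    rw [Matrix.eval_charpoly] at ht
    simpa using ht
  have hall : ∀ u : Finset ι, ∃ ε : ι → F, (∀ i ∈ u, ε i = -1 ∨ ε i = 1) ∧
      (Matrix.diagonal ε + g).det ≠ 0 := by
    intro u
    induction u using Finset.induction_on with
    | empty => obtain ⟨ε, hε⟩ := hstart; exact ⟨ε, by simp, hε⟩
    | insert i u hi ih =>
      obtain ⟨ε, hε, hd⟩ := ih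
      obtain ⟨a, b, hab⟩ := haff ε i
      have hne : a + (-1) * b ≠ 0 ∨ a + 1 * b ≠ 0 := by
        by_contra! h
        apply hd
        have hb : b = 0 := by linear_combination (h.2 - h.1) / 2
        have ha : a = 0 := by linear_combination (h.2 + h.1) / 2
        have h1 := hab (ε i)
        rwa [Function.update_eq_self, ha, hb, mul_zero, add_zero] at h1
      have hother : ∀ t, ∀ j ∈ u, Function.update ε i t j = -1 ∨ Function.update ε i t j = 1 := by
        intro t j hj
        rw [Function.update_of_ne (by rintro rfl; exact hi hj)]
        exact hε j hj
      rcases hne with h | h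
      · exact ⟨Function.update ε i (-1), by simpa using hother (-1), by rwa [hab]⟩
      · exact ⟨Function.update ε i 1, by simpa using hother 1, by rwa [hab]⟩
  obtain ⟨ε, hε, hd⟩ := hall Finset.univ
  classical
  refine ⟨Finset.univ.filter fun i => ε i = -1, ?_⟩
  have : signDiag F (Finset.univ.filter fun i => ε i = -1) = Matrix.diagonal ε := by
    rw [signDiag]
    congr 1
    ext i
    have h11 : (1 : F) ≠ -1 := fun h => two_ne_zero (α := F) (by linear_combination h)
    rcases hε i (Finset.mem_univ i) with h | h <;> simp [h, h11]
  rwa [this]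

variable {F : Type*} [Field F]

/-- The Cayley transform. -/
noncomputable def cayley (S : Matrix ι ι F) : Matrix ι ι F := (1 - S) * (1 + S)⁻¹

theorem cayley_mul (S : Matrix ι ι F) (h : (1 + S).det ≠ 0) : cayley S * (1 + S) = 1 - S := by
  rw [cayley, Matrix.mul_assoc, Matrix.nonsing_inv_mul _ (isUnit_iff_ne_zero.2 h), Matrix.mul_one]

theorem cayley_eq_of_mul {S A : Matrix ι ι F} (h : (1 + S).det ≠ 0) (hA : A * (1 + S) = 1 - S) :
    A = cayley S := by
  rw [cayley, ← hA, Matrix.mul_assoc, Matrix.mul_nonsing_inv _ (isUnit_iff_ne_zero.2 h),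
    Matrix.mul_one]

theorem one_sub_det_of_skew {S : Matrix ι ι F} (hS : Sᵀ = -S) : (1 - S).det = (1 + S).det := by
  rw [← Matrix.det_transpose (1 + S), Matrix.transpose_add, hS, Matrix.transpose_one, sub_eq_add_neg]

theorem cayley_orthogonal {S : Matrix ι ι F} (hS : Sᵀ = -S) (h : (1 + S).det ≠ 0) :
    cayley S * (cayley S)ᵀ = 1 := by
  have h' : (1 - S).det ≠ 0 := by rwa [one_sub_det_of_skew hS]
  have h1 := congrArg Matrix.transpose (cayley_mul S h)
  rw [Matrix.transpose_mul, Matrix.transpose_add, Matrix.transpose_sub, hS, Matrix.transpose_one,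
    ← sub_eq_add_neg, sub_neg_eq_add] at h1
  apply mul_eq_one_comm.1
  have hu : IsUnit (1 + S) := (Matrix.isUnit_iff_isUnit_det _).2 (isUnit_iff_ne_zero.2 h)
  have hu' : IsUnit (1 - S) := (Matrix.isUnit_iff_isUnit_det _).2 (isUnit_iff_ne_zero.2 h')
  apply hu.mul_right_cancel
  apply hu'.mul_left_cancel
  rw [mul_assoc, cayley_mul S h, ← mul_assoc, h1]
  noncomm_ring

theorem det_cayley {S : Matrix ι ι F} (hS : Sᵀ = -S) (h : (1 + S).det ≠ 0) :
    (cayley S).det = 1 := by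
  have h1 := congrArg Matrix.det (cayley_mul S h)
  rw [Matrix.det_mul, one_sub_det_of_skew hS] at h1
  exact mul_right_cancel₀ h (by rw [h1, one_mul])

variable [CharZero F]

omit [CharZero F] in
theorem one_add_cayley_mul (g : Matrix ι ι F) (h : (1 + g).det ≠ 0) :
    (1 + cayley g) * (1 + g) = (2 : F) • 1 := by
  rw [add_mul, cayley_mul g h, two_smul]
  noncomm_ring

theorem det_one_add_cayley_ne_zero (g : Matrix ι ι F) (h : (1 + g).det ≠ 0) :
    (1 + cayley g).det ≠ 0 := by
  have h1 := congrArg Matrix.det (one_add_cayley_mul g h)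
  rw [Matrix.det_mul, Matrix.det_smul, Matrix.det_one, mul_one] at h1
  intro h2
  rw [h2, zero_mul] at h1
  exact pow_ne_zero _ two_ne_zero h1.symm

theorem cayley_cayley (g : Matrix ι ι F) (h : (1 + g).det ≠ 0) : cayley (cayley g) = g := by
  symm
  apply cayley_eq_of_mul (det_one_add_cayley_ne_zero g h)
  have hu : IsUnit (1 + g) := (Matrix.isUnit_iff_isUnit_det _).2 (isUnit_iff_ne_zero.2 h)
  apply hu.mul_right_cancel
  rw [mul_assoc, one_add_cayley_mul g h, sub_mul, cayley_mul g h, mul_smul_comm, two_smul]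
  noncomm_ring

omit [CharZero F] in
theorem cayley_transpose_of_orthogonal {g : Matrix ι ι F} (hg : g * gᵀ = 1)
    (h : (1 + g).det ≠ 0) : (cayley g)ᵀ = -cayley g := by
  have h1 := congrArg Matrix.transpose (cayley_mul g h)
  have hu : IsUnit (1 + g) := (Matrix.isUnit_iff_isUnit_det _).2 (isUnit_iff_ne_zero.2 h)
  have hu' : IsUnit (1 + gᵀ) := by
    rw [← Matrix.transpose_one, ← Matrix.transpose_add, Matrix.isUnit_transpose]; exact hu
  rw [Matrix.transpose_mul, Matrix.transpose_add, Matrix.transpose_sub, Matrix.transpose_one] at h1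
  apply hu.mul_right_cancel
  apply hu'.mul_left_cancel
  rw [neg_mul, cayley_mul g h, ← mul_assoc, h1]
  have hg' : gᵀ * g = 1 := mul_eq_one_comm.1 hg
  simp only [sub_mul, add_mul, mul_add, mul_sub, mul_neg, hg', one_mul, mul_one]
  abel

end Cayley

/-! ### Irreducibility of the special orthogonal group -/

section Irreducible

variable {ι : Type*} [Fintype ι] [DecidableEq ι]

/-- The equations defining the special orthogonal group, for a matrix over a ring. -/
def IsSO {R : Type*} [CommRing R] (X : Matrix ι ι R) : Prop := X * Xᵀ = 1 ∧ X.det = 1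

theorem exists_polynomial_numerator {L : Type*} [Field L] {τ : Type*}
    (N : τ → Polynomial L) (d : Polynomial L) (p : MvPolynomial τ L) :
    ∃ (P : Polynomial L) (D : ℕ), ∀ t, d.eval t ≠ 0 →
      d.eval t ^ D * MvPolynomial.eval (fun i => (N i).eval t / d.eval t) p = P.eval t := by
  induction p using MvPolynomial.induction_on with
  | C a => exact ⟨Polynomial.C a, 0, fun t _ => by simp⟩
  | add p q hp hq =>
    obtain ⟨P, D, hP⟩ := hp
    obtain ⟨Q, E, hQ⟩ := hq
    refine ⟨d ^ E * P + d ^ D * Q, D + E, fun t ht => ?_⟩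
    rw [map_add, Polynomial.eval_add, Polynomial.eval_mul, Polynomial.eval_mul, ← hP t ht,
      ← hQ t ht, Polynomial.eval_pow, Polynomial.eval_pow]
    ring
  | mul_X p i hp =>
    obtain ⟨P, D, hP⟩ := hp
    refine ⟨P * N i, D + 1, fun t ht => ?_⟩
    rw [map_mul, Polynomial.eval_mul, ← hP t ht, MvPolynomial.eval_X]
    field_simp
    ring

variable {k : Type*} [Field k] [CharZero k] {L : Type*} [Field L] [Algebra k L]

/-- Evaluation of a polynomial over `L` in the matrix entries at a matrix over `k`. -/
noncomputable def evalAt (p : MvPolynomial (ι × ι) L) (g : Matrix ι ι k) : L :=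
  MvPolynomial.eval (fun ij => algebraMap k L (g ij.1 ij.2)) p

/-- The chart is parametrised by skew matrices. On the line joining the two parameters, `p` and `q`
become nonzero one-variable polynomials after clearing denominators, and an infinite field has a
point avoiding their roots and the poles. -/
theorem exists_common_nonvanishing_in_chart (s : Finset ι) (p q : MvPolynomial (ι × ι) L)
    {g₀ g₁ : Matrix ι ι k} (h₀ : IsSO g₀) (h₁ : IsSO g₁)
    (hd₀ : (signDiag k s + g₀).det ≠ 0) (hd₁ : (signDiag k s + g₁).det ≠ 0)
    (hp : evalAt p g₀ ≠ 0) (hq : evalAt q g₁ ≠ 0) :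
    ∃ g : Matrix ι ι k, IsSO g ∧ (signDiag k s + g).det ≠ 0 ∧ evalAt p g ≠ 0 ∧ evalAt q g ≠ 0 := by
  set E := signDiag k s with hE
  have hEE : E * E = 1 := signDiag_mul_self k s
  have hEdet : E.det * E.det = 1 := by rw [← Matrix.det_mul, hEE, Matrix.det_one]
  have hEdet0 : E.det ≠ 0 := left_ne_zero_of_mul (hEdet ▸ one_ne_zero)
  have hchart : ∀ g : Matrix ι ι k, (1 + E * g).det ≠ 0 ↔ (E + g).det ≠ 0 := by
    intro g
    rw [← hEE, ← mul_add, Matrix.det_mul, mul_ne_zero_iff, and_iff_right hEdet0]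
  have horth : ∀ g : Matrix ι ι k, g * gᵀ = 1 → (E * g) * (E * g)ᵀ = 1 := by
    intro g hg
    rw [Matrix.transpose_mul, signDiag_transpose, ← hE, mul_assoc, ← mul_assoc g, hg, one_mul, hEE]
  have hc₀ := (hchart g₀).2 hd₀
  have hc₁ := (hchart g₁).2 hd₁
  set S₀ := cayley (E * g₀) with hS₀
  set S₁ := cayley (E * g₁) with hS₁
  -- Cayley transforms of skew matrices have determinant 1, so a chart containing a point of
  -- determinant 1 has an even number of signs.
  have hE1 : E.det = 1 := by
    have h1 := congrArg Matrix.det (cayley_cayley _ hc₀)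
    rw [det_cayley (cayley_transpose_of_orthogonal (horth _ h₀.1) hc₀)
      (det_one_add_cayley_ne_zero _ hc₀), Matrix.det_mul, h₀.2, mul_one] at h1
    exact h1.symm
  let Sp : Matrix ι ι (Polynomial k) := S₀.map Polynomial.C +
    (Polynomial.X : Polynomial k) • (S₁ - S₀).map Polynomial.C
  let S : k → Matrix ι ι k := fun t => S₀ + t • (S₁ - S₀)
  have hSp : ∀ t, (Polynomial.evalRingHom t).mapMatrix Sp = S t := by
    intro t
    ext i j
    simp [Sp, S]
  have hskew : ∀ t, (S t)ᵀ = -S t := by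
    intro t
    simp only [S, Matrix.transpose_add, Matrix.transpose_smul, Matrix.transpose_sub]
    rw [hS₀, hS₁, cayley_transpose_of_orthogonal (horth _ h₀.1) hc₀,
      cayley_transpose_of_orthogonal (horth _ h₁.1) hc₁, neg_add, ← smul_neg]
    congr 2
    abel
  let d : Polynomial k := (1 + Sp).det
  let N : Matrix ι ι (Polynomial k) := E.map Polynomial.C * ((1 - Sp) * (1 + Sp).adjugate)
  have hd : ∀ t, d.eval t = (1 + S t).det := by
    intro t
    rw [← hSp t, ← Polynomial.coe_evalRingHom, RingHom.map_det, map_add, map_one]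
  have hN : ∀ t i j, d.eval t ≠ 0 → (N i j).eval t / d.eval t = (E * cayley (S t)) i j := by
    intro t i j ht
    have h1 : (Polynomial.evalRingHom t).mapMatrix N = E * ((1 - S t) * (1 + S t).adjugate) := by
      have h2 : (Polynomial.evalRingHom t).mapMatrix (E.map Polynomial.C) = E := by
        ext i j; simp
      rw [map_mul, map_mul, h2, RingHom.map_adjugate, map_add, map_sub, map_one, hSp]
    have h3 : E * cayley (S t) = (d.eval t)⁻¹ • (E * ((1 - S t) * (1 + S t).adjugate)) := by
      rw [cayley, Matrix.inv_def, hd, Ring.inverse_eq_inv', mul_smul_comm, mul_smul_comm]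
    rw [h3, ← h1, Matrix.smul_apply, smul_eq_mul, div_eq_inv_mul]
    rfl
  have hend₀ : E * cayley (S 0) = g₀ := by
    simp only [S, zero_smul, add_zero]
    rw [hS₀, cayley_cayley _ hc₀, ← mul_assoc, hEE, one_mul]
  have hend₁ : E * cayley (S 1) = g₁ := by
    simp only [S, one_smul, add_sub_cancel]
    rw [hS₁, cayley_cayley _ hc₁, ← mul_assoc, hEE, one_mul]
  have hdz : d.eval 0 ≠ 0 := by
    rw [hd]; simp only [S, zero_smul, add_zero]; exact det_one_add_cayley_ne_zero _ hc₀
  have hdo : d.eval 1 ≠ 0 := by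
    rw [hd]; simp only [S, one_smul, add_sub_cancel]; exact det_one_add_cayley_ne_zero _ hc₁
  have hev : ∀ r : MvPolynomial (ι × ι) L, ∃ (P : Polynomial L) (D : ℕ), ∀ t : k, d.eval t ≠ 0 →
      algebraMap k L (d.eval t) ^ D * evalAt r (E * cayley (S t)) = P.eval (algebraMap k L t) := by
    intro r
    obtain ⟨P, D, hP⟩ := exists_polynomial_numerator
      (fun ij : ι × ι => (N ij.1 ij.2).map (algebraMap k L)) (d.map (algebraMap k L)) r
    refine ⟨P, D, fun t ht => ?_⟩
    have hmap : ∀ f : Polynomial k, (f.map (algebraMap k L)).eval (algebraMap k L t) =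
        algebraMap k L (f.eval t) := fun f => by
      rw [Polynomial.eval_map, Polynomial.eval₂_at_apply]
    have h1 := hP (algebraMap k L t) (by rw [hmap]; simpa using ht)
    rw [← h1, hmap, evalAt]
    congr 3
    ext ij
    rw [hmap, ← map_div₀, hN t _ _ ht]
  obtain ⟨P, D, hP⟩ := hev p
  obtain ⟨Q, D', hQ⟩ := hev q
  have hP0 : P ≠ 0 := by
    rintro rfl
    have h1 := hP 0 hdz
    rw [hend₀, Polynomial.eval_zero] at h1
    exact (mul_ne_zero (pow_ne_zero _ (by simpa using hdz)) hp) h1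
  have hQ0 : Q ≠ 0 := by
    rintro rfl
    have h1 := hQ 1 hdo
    rw [hend₁, Polynomial.eval_zero] at h1
    exact (mul_ne_zero (pow_ne_zero _ (by simpa using hdo)) hq) h1
  have hd0 : d ≠ 0 := by rintro h; rw [h] at hdz; simp at hdz
  have hdL : d.map (algebraMap k L) ≠ 0 := by rwa [Ne, Polynomial.map_eq_zero]
  obtain ⟨t, ht⟩ : ∃ t : k, (d.map (algebraMap k L) * P * Q).eval (algebraMap k L t) ≠ 0 := by
    by_contra! hcon
    refine mul_ne_zero (mul_ne_zero hdL hP0) hQ0 (Polynomial.eq_zero_of_infinite_isRoot _ ?_)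
    exact (Set.infinite_range_of_injective (algebraMap k L).injective).mono
      (by rintro _ ⟨t, rfl⟩; exact hcon t)
  rw [Polynomial.eval_mul, Polynomial.eval_mul, mul_ne_zero_iff, mul_ne_zero_iff,
    Polynomial.eval_map, Polynomial.eval₂_at_apply] at ht
  have htd : d.eval t ≠ 0 := by simpa using ht.1.1
  have hS1 : (1 + S t).det ≠ 0 := by rwa [← hd]
  refine ⟨E * cayley (S t), ⟨horth _ (cayley_orthogonal (hskew t) hS1), ?_⟩, ?_, ?_, ?_⟩
  · rw [Matrix.det_mul, hE1, det_cayley (hskew t) hS1, one_mul]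
  · rw [← hchart, ← mul_assoc, hEE, one_mul]
    exact det_one_add_cayley_ne_zero _ hS1
  · exact right_ne_zero_of_mul ((hP t htd).trans_ne ht.1.2)
  · exact right_ne_zero_of_mul ((hQ t htd).trans_ne ht.2)

/-- The right-angle rotation in the (i, j)-plane has neither 1 nor -1 as eigenvalue on that plane,
so it lies in both charts and links them. -/
theorem exists_quarter_turn {i j : ι} (hij : i ≠ j) :
    ∃ A : Matrix ι ι k, IsSO A ∧ (1 + A).det ≠ 0 ∧ (signDiag k {i, j} + A).det ≠ 0 := by
  set P : Matrix ι ι k := Matrix.single i i 1 + Matrix.single j j 1 with hP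
  set S : Matrix ι ι k := Matrix.single i j 1 - Matrix.single j i 1 with hS
  have hji := hij.symm
  have hPP : P * P = P := by
    simp [hP, mul_add, add_mul, hij, hji]
  have hPS : P * S = S := by
    simp [hP, hS, mul_sub, add_mul, hij, hji]
  have hSP : S * P = S := by
    simp [hP, hS, mul_add, sub_mul, hij, hji]
    abel
  have hSS : S * S = -P := by
    simp [hP, hS, mul_sub, sub_mul, hij, hji]
    abel
  have hST : Sᵀ = -S := by simp [hS, Matrix.transpose_single]
  have hPT : Pᵀ = P := by simp [hP, Matrix.transpose_single]
  have hE : signDiag k {i, j} = 1 - P - P := by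
    ext a b
    by_cases hab : a = b
    · subst hab
      by_cases h1 : a = i
      · subst h1; simp [signDiag, hP, hij, hji]
      · by_cases h2 : a = j
        · subst h2; simp [signDiag, hP, hij, hji]
        · simp [signDiag, hP, h1, h2, Ne.symm h1, Ne.symm h2]
    · have h1 : ∀ c : ι, ¬(c = a ∧ c = b) := by rintro c ⟨rfl, rfl⟩; exact hab rfl
      simp [signDiag, hP, hab, h1]
  -- In both uses `B * C` is 4 off the (i, j)-plane and 2 on it; the factor `1 + P` evens this out
  -- to the scalar 4.
  have hne : ∀ B C : Matrix ι ι k, B * C * (1 + P) = (4 : k) • 1 → B.det ≠ 0 := by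
    intro B C h h0
    have h1 := congrArg Matrix.det h
    rw [Matrix.det_mul, Matrix.det_mul, h0, Matrix.det_smul, Matrix.det_one, mul_one, zero_mul,
      zero_mul] at h1
    exact pow_ne_zero _ (by norm_num : (4 : k) ≠ 0) h1.symm
  have h4 : (4 : k) • (1 : Matrix ι ι k) = 1 + 1 + 1 + 1 := by
    rw [show (4 : k) = 1 + 1 + 1 + 1 by norm_num]
    simp only [add_smul, one_smul]
  have horth : (1 - P + S) * (1 - P + S)ᵀ = 1 := by
    simp only [Matrix.transpose_add, Matrix.transpose_sub, hST, hPT, Matrix.transpose_one, mul_add,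
      add_mul, mul_sub, sub_mul, mul_neg, hPP, hPS, hSP, hSS, one_mul, mul_one]
    abel
  have hd : (1 + (1 - P + S)).det ≠ 0 := by
    refine hne _ (1 + (1 - P - S)) ?_
    simp only [mul_add, add_mul, mul_sub, sub_mul, neg_mul, hPP, hPS, hSP, hSS, one_mul,
      mul_one, h4]
    abel
  refine ⟨1 - P + S, ⟨horth, ?_⟩, hd, ?_⟩
  · rw [← cayley_cayley _ hd]
    exact det_cayley (cayley_transpose_of_orthogonal horth hd) (det_one_add_cayley_ne_zero _ hd)
  · rw [hE]
    refine hne _ (1 - P - P + (1 - P - S)) ?_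
    simp only [mul_add, add_mul, mul_sub, sub_mul, neg_mul, hPP, hPS, hSP, hSS, one_mul,
      mul_one, h4]
    abel

/-- Signs are removed two at a time: `signDiag k s` times a quarter turn in the (i, j)-plane lies in
the chart of `s` and in that of `s` without i, j. The one-chart lemma then moves the nonvanishing of
`p` into the overlap. -/
theorem exists_nonvanishing_in_cayley_chart (p : MvPolynomial (ι × ι) L) (r : ℕ) :
    ∀ (s : Finset ι), s.card = 2 * r → ∀ (g : Matrix ι ι k), IsSO g →
      (signDiag k s + g).det ≠ 0 → evalAt p g ≠ 0 →
      ∃ g' : Matrix ι ι k, IsSO g' ∧ (signDiag k ∅ + g').det ≠ 0 ∧ evalAt p g' ≠ 0 := by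
  induction r with
  | zero =>
    intro s hs g hg hd hp
    rw [mul_zero, Finset.card_eq_zero] at hs
    subst hs
    exact ⟨g, hg, hd, hp⟩
  | succ r ih =>
    intro s hs g hg hd hp
    obtain ⟨i, hi, j, hj, hij⟩ := Finset.one_lt_card.1 (show 1 < s.card by omega)
    set s' := s \ {i, j} with hs'
    have hsub : ({i, j} : Finset ι) ⊆ s := by
      intro a ha; rcases Finset.mem_insert.1 ha with rfl | ha
      · exact hi
      · rw [Finset.mem_singleton.1 ha]; exact hj
    have hcard : s'.card = 2 * r := by
      rw [hs', Finset.card_sdiff_of_subset hsub, Finset.card_pair hij]; omega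
    have hmul : signDiag k s * signDiag k {i, j} = signDiag k s' := by
      rw [signDiag, signDiag, signDiag, Matrix.diagonal_mul_diagonal]
      congr 1
      ext a
      by_cases h1 : a ∈ ({i, j} : Finset ι)
      · simp only [hsub h1, h1, hs', Finset.mem_sdiff, not_true, and_false, if_true, if_false]
        norm_num
      · simp only [h1, hs', Finset.mem_sdiff, not_false_iff, and_true, if_false, mul_one]
    have hdets : (signDiag k s).det = 1 := by
      rw [det_signDiag, hs, pow_mul]; simp
    obtain ⟨A, hA, hA1, hA2⟩ := exists_quarter_turn (k := k) hij
    let q : MvPolynomial (ι × ι) L := ((signDiag L s').map MvPolynomial.C +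
      Matrix.of fun a b => MvPolynomial.X (a, b)).det
    have hq : ∀ B : Matrix ι ι k, evalAt q B = algebraMap k L (signDiag k s' + B).det := by
      intro B
      rw [evalAt, RingHom.map_det, RingHom.map_det]
      congr 1
      ext a b
      by_cases hab : a = b
      · subst hab; by_cases h : a ∈ s' <;> simp [signDiag, h]
      · simp [signDiag, hab]
    obtain ⟨g', hg', hd', hp', hq'⟩ := exists_common_nonvanishing_in_chart s p q hg
      (g₁ := signDiag k s * A)
      ⟨by rw [Matrix.transpose_mul, mul_assoc, ← mul_assoc A, hA.1, one_mul, signDiag_transpose,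
          signDiag_mul_self], by rw [Matrix.det_mul, hdets, hA.2, one_mul]⟩ hd
      (by
        have : signDiag k s + signDiag k s * A = signDiag k s * (1 + A) := by rw [mul_add, mul_one]
        rw [this, Matrix.det_mul, hdets, one_mul]
        exact hA1) hp
      (by
        rw [hq, ← hmul, ← mul_add, Matrix.det_mul, hdets, one_mul]
        simpa using hA2)
    exact ih s' hcard g' hg' (by rw [hq] at hq'; simpa using hq') hp'

/-- The special orthogonal group is irreducible. -/
theorem exists_common_nonvanishing (p q : MvPolynomial (ι × ι) L) {g₀ g₁ : Matrix ι ι k}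
    (h₀ : IsSO g₀) (h₁ : IsSO g₁) (hp : evalAt p g₀ ≠ 0) (hq : evalAt q g₁ ≠ 0) :
    ∃ g : Matrix ι ι k, IsSO g ∧ evalAt p g ≠ 0 ∧ evalAt q g ≠ 0 := by
  have key : ∀ (p : MvPolynomial (ι × ι) L) (g : Matrix ι ι k), IsSO g → evalAt p g ≠ 0 →
      ∃ g' : Matrix ι ι k, IsSO g' ∧ (signDiag k ∅ + g').det ≠ 0 ∧ evalAt p g' ≠ 0 := by
    intro p g hg hp
    obtain ⟨s, hs⟩ := exists_det_signDiag_add_ne_zero g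
    have hEE := signDiag_mul_self k s
    have hc : (1 + signDiag k s * g).det ≠ 0 := by
      rw [← hEE, ← mul_add, Matrix.det_mul]
      refine mul_ne_zero ?_ hs
      rw [det_signDiag]
      exact pow_ne_zero _ (neg_ne_zero.2 one_ne_zero)
    have horth : (signDiag k s * g) * (signDiag k s * g)ᵀ = 1 := by
      rw [Matrix.transpose_mul, signDiag_transpose, mul_assoc, ← mul_assoc g, hg.1, one_mul, hEE]
    have h1 := congrArg Matrix.det (cayley_cayley _ hc)
    rw [det_cayley (cayley_transpose_of_orthogonal horth hc)
      (det_one_add_cayley_ne_zero _ hc), Matrix.det_mul, hg.2, mul_one, det_signDiag] at h1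
    obtain ⟨r, hr⟩ : Even s.card := by
      by_contra hodd
      rw [(Nat.not_even_iff_odd.1 hodd).neg_one_pow] at h1
      have : (2 : k) = 0 := by linear_combination h1
      exact two_ne_zero this
    exact exists_nonvanishing_in_cayley_chart p r s (by omega) g hg hs hp
  obtain ⟨a, ha, hda, hpa⟩ := key p g₀ h₀ hp
  obtain ⟨b, hb, hdb, hqb⟩ := key q g₁ h₁ hq
  obtain ⟨g, hg, _, hpg, hqg⟩ := exists_common_nonvanishing_in_chart ∅ p q ha hb hda hdb hpa hqb
  exact ⟨g, hg, hpg, hqg⟩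

end Irreducible

/-! ### Transcendence degree of a maximal isotropic subspace -/

theorem trdeg_add_trdeg_restrictScalars {K Ω : Type*} [Field K] [Field Ω] [Algebra K Ω]
    (E : IntermediateField K Ω) (A : IntermediateField E Ω) :
    Algebra.trdeg K E + Algebra.trdeg E A = Algebra.trdeg K (A.restrictScalars K) := by
  let _ : Algebra E (A.restrictScalars K) := inferInstanceAs (Algebra E A)
  have : FaithfulSMul E (A.restrictScalars K) :=
    (faithfulSMul_iff_algebraMap_injective _ _).2 (algebraMap E A).injective
  have : FaithfulSMul K E := (faithfulSMul_iff_algebraMap_injective K E).2 (algebraMap K E).injective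
  have : IsScalarTower K E (A.restrictScalars K) := IsScalarTower.of_algebraMap_eq fun _ => rfl
  exact trdeg_add_eq K E (A := A.restrictScalars K)

theorem trdeg_adjoin_le_mk {K Ω : Type u} [Field K] [Field Ω] [Algebra K Ω] (s t : Set Ω)
    (h : ∀ x ∈ t, IsAlgebraic (IntermediateField.adjoin K s) x) :
    Algebra.trdeg K (IntermediateField.adjoin K t) ≤ Cardinal.mk s := by
  let E := IntermediateField.adjoin K s
  let A : IntermediateField K Ω := (algebraicClosure E Ω).restrictScalars K
  have hle : IntermediateField.adjoin K t ≤ A := by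
    rw [IntermediateField.adjoin_le_iff]
    intro x hx
    exact mem_algebraicClosure_iff.2 (h x hx)
  have h1 : Algebra.trdeg K (IntermediateField.adjoin K t) ≤ Algebra.trdeg K A :=
    trdeg_le_of_injective (IntermediateField.inclusion hle)
      (IntermediateField.inclusion hle).injective
  have h2 := trdeg_add_trdeg_restrictScalars E (algebraicClosure E Ω)
  rw [trdeg_eq_zero (R := E), add_zero] at h2
  let s' : Set E := Subtype.val ⁻¹' s
  have himg : Subtype.val '' s' = s := by
    exact (Subtype.image_preimage_coe _ _).trans
      (Set.inter_eq_right.2 (IntermediateField.subset_adjoin K s))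
  have htop : IntermediateField.adjoin K s' = ⊤ := by
    apply IntermediateField.map_injective E.val
    rw [IntermediateField.adjoin_map, ← AlgHom.fieldRange_eq_map, IntermediateField.fieldRange_val]
    congr 1
  have halg : Algebra.IsAlgebraic (Algebra.adjoin K s') E := by
    rw [← IntermediateField.isAlgebraic_adjoin_iff_top, htop]
    exact ⟨fun x => isAlgebraic_algebraMap (⟨x, trivial⟩ : (⊤ : IntermediateField K E))⟩
  have h3 : Algebra.trdeg K E ≤ Cardinal.mk s' := Algebra.IsAlgebraic.trdeg_le_cardinalMk K s'
  calc _ ≤ _ := h1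
    _ = _ := h2.symm
    _ ≤ _ := h3
    _ = Cardinal.mk (Subtype.val '' s') := (Cardinal.mk_image_eq Subtype.val_injective).symm
    _ = _ := by rw [himg]

/-- Over an algebraic closure, scaling rows by √b_i and columns by 1/√(-a_i) makes `C` orthogonal,
hence up to signs a Cayley transform of a skew matrix. So `C` is algebraic over the field generated
by the entries of that matrix above the diagonal. -/
theorem trdeg_isotropic_chart_le {K L : Type u} [Field K] [Field L] [CharZero L] [Algebra K L]
    {m : ℕ} (C : Matrix (Fin m) (Fin m) L) (a b : Fin m → K) (ha : ∀ i, a i ≠ 0)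
    (hb : ∀ i, b i ≠ 0)
    (hC : Matrix.diagonal (fun i => algebraMap K L (a i)) +
      Cᵀ * Matrix.diagonal (fun i => algebraMap K L (b i)) * C = 0) :
    Algebra.trdeg K (IntermediateField.adjoin K
      (Set.range fun p : Fin m × Fin m => C p.1 p.2)) ≤ ((m * (m - 1) / 2 : ℕ) : Cardinal) := by
  let Ω := AlgebraicClosure L
  have : CharZero Ω := charZero_of_injective_algebraMap (algebraMap L Ω).injective
  let j := IsScalarTower.toAlgHom K L Ω
  have hsq : ∀ x : K, ∃ y : Ω, y ^ 2 = algebraMap K Ω x := fun x =>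
    IsAlgClosed.exists_pow_nat_eq _ two_pos
  choose sq hsq using hsq
  have hsq0 : ∀ x, x ≠ 0 → sq x ≠ 0 := by
    intro x hx h0
    have := hsq x
    rw [h0, zero_pow two_ne_zero] at this
    exact hx ((map_eq_zero _).1 this.symm)
  let C' : Matrix (Fin m) (Fin m) Ω := C.map j
  let α : Fin m → Ω := fun i => sq (-a i)
  let β : Fin m → Ω := fun i => sq (b i)
  have hα0 : ∀ i, α i ≠ 0 := fun i => hsq0 _ (neg_ne_zero.2 (ha i))
  have hβ0 : ∀ i, β i ≠ 0 := fun i => hsq0 _ (hb i)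
  let O : Matrix (Fin m) (Fin m) Ω :=
    Matrix.diagonal β * C' * Matrix.diagonal fun i => (α i)⁻¹
  have hC' : C'ᵀ * (Matrix.diagonal β * Matrix.diagonal β) * C' =
      Matrix.diagonal α * Matrix.diagonal α := by
    have h1 := congrArg (fun M => M.map j) hC
    have h2 : ∀ x : Fin m → K, (Matrix.diagonal fun i => algebraMap K L (x i)).map j =
        Matrix.diagonal fun i => algebraMap K Ω (x i) := by
      intro x
      rw [Matrix.diagonal_map (map_zero j)]
      congr 1
    simp only [Matrix.map_add j (map_add j), Matrix.map_mul, h2, Matrix.transpose_map,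
      Matrix.map_zero j (map_zero j)] at h1
    simp only [Matrix.diagonal_mul_diagonal, C']
    have h3 : (fun i => β i * β i) = fun i => algebraMap K Ω (b i) := by
      ext i; rw [← hsq, pow_two]
    have h4 : (fun i => α i * α i) = -fun i => algebraMap K Ω (a i) := by
      ext i
      rw [Pi.neg_apply, ← map_neg, ← hsq, pow_two]
    have h5 : Matrix.diagonal (-fun i => algebraMap K Ω (a i)) =
        -Matrix.diagonal fun i => algebraMap K Ω (a i) := (Matrix.diagonal_neg _).symm
    rw [h3, h4, h5, eq_neg_iff_add_eq_zero, add_comm, ← h1]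
  have hαinv : (Matrix.diagonal fun i => (α i)⁻¹) * Matrix.diagonal α = 1 := by
    rw [Matrix.diagonal_mul_diagonal, ← Matrix.diagonal_one]
    congr 1; ext i; exact inv_mul_cancel₀ (hα0 i)
  have hO : O * Oᵀ = 1 := by
    apply mul_eq_one_comm.1
    have hdT : ∀ x : Fin m → Ω, (Matrix.diagonal x)ᵀ = Matrix.diagonal x :=
      fun x => Matrix.diagonal_transpose x
    calc Oᵀ * O = (Matrix.diagonal fun i => (α i)⁻¹) *
          (C'ᵀ * (Matrix.diagonal β * Matrix.diagonal β) * C') *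
          (Matrix.diagonal fun i => (α i)⁻¹) := by
          simp only [O, Matrix.transpose_mul, hdT, mul_assoc]
      _ = ((Matrix.diagonal fun i => (α i)⁻¹) * Matrix.diagonal α) *
          (Matrix.diagonal α * (Matrix.diagonal fun i => (α i)⁻¹)) := by
          rw [hC']; simp only [mul_assoc]
      _ = 1 := by rw [mul_eq_one_comm.1 hαinv, hαinv, one_mul]
  obtain ⟨s, hs⟩ := exists_det_signDiag_add_ne_zero O
  have hEE := signDiag_mul_self Ω s
  set g := signDiag Ω s * O with hg
  have hgd : (1 + g).det ≠ 0 := by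
    rw [← hEE, hg, ← mul_add, Matrix.det_mul]
    exact mul_ne_zero (by rw [det_signDiag]; exact pow_ne_zero _ (neg_ne_zero.2 one_ne_zero)) hs
  have hgo : g * gᵀ = 1 := by
    rw [hg, Matrix.transpose_mul, signDiag_transpose, mul_assoc, ← mul_assoc O, hO, one_mul, hEE]
  set S := cayley g with hS
  have hSk : Sᵀ = -S := cayley_transpose_of_orthogonal hgo hgd
  -- The index type lists the positions strictly above the diagonal, by column; its size is the sum
  -- of all i < m.
  let S₀ : (Σ i : Fin m, Fin i) → Ω := fun p => S (Fin.castLE p.1.2.le p.2) p.1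
  set E := IntermediateField.adjoin K (Set.range S₀) with hE
  have hSlt : ∀ p q : Fin m, p < q → S p q ∈ E := fun p q h =>
    IntermediateField.subset_adjoin K _ ⟨⟨q, ⟨p, h⟩⟩, rfl⟩
  have hSneg : ∀ p q, S q p = -S p q := fun p q => congrFun (congrFun hSk p) q
  have hSE : ∀ p q, S p q ∈ E := by
    intro p q
    rcases lt_trichotomy p q with h | h | h
    · exact hSlt p q h
    · subst h
      have h1 : (2 : Ω) * S p p = 0 := by linear_combination hSneg p p
      rw [(mul_eq_zero.1 h1).resolve_left two_ne_zero]
      exact zero_mem _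
    · rw [hSneg]; exact neg_mem (hSlt q p h)
  have hgE : ∀ p q, g p q ∈ E := by
    intro p q
    let SE : Matrix (Fin m) (Fin m) E := Matrix.of fun p q => ⟨S p q, hSE p q⟩
    have h1 : SE.map E.val = S := rfl
    have h2 : (cayley SE).map E.val = cayley S := by
      rw [cayley, cayley, Matrix.map_mul, Matrix.inv_def, Matrix.inv_def, ← h1]
      have h3 : (1 + SE).map E.val = 1 + SE.map E.val := by
        rw [Matrix.map_add _ (map_add _), Matrix.map_one _ (map_zero _) (map_one _)]
      have h5 : (1 - SE).map E.val = 1 - SE.map E.val := by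
        rw [Matrix.map_sub _ (map_sub _), Matrix.map_one _ (map_zero _) (map_one _)]
      have h4 := AlgHom.map_adjugate E.val (1 + SE)
      have h6 := AlgHom.map_det E.val (1 + SE)
      rw [AlgHom.mapMatrix_apply, AlgHom.mapMatrix_apply, h3] at h4
      rw [AlgHom.mapMatrix_apply, h3] at h6
      rw [h5, ← h4, ← h6]
      congr 1
      ext a b
      simp only [Ring.inverse_eq_inv', Matrix.map_apply, Matrix.smul_apply, smul_eq_mul, map_mul,
        map_inv₀]
      congr 1
      exact (Ring.inverse_eq_inv _).symm
    rw [← cayley_cayley g hgd, ← hS, ← h2]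
    exact (cayley SE p q).2
  have hcard : Cardinal.mk (Set.range S₀) ≤ ((m * (m - 1) / 2 : ℕ) : Cardinal) := by
    have h1 := Cardinal.mk_range_le_lift (f := S₀)
    rw [Cardinal.lift_uzero] at h1
    refine h1.trans ?_
    rw [Cardinal.mk_fintype, Fintype.card_sigma]
    simp only [Fintype.card_fin, Cardinal.lift_natCast, Nat.cast_le]
    rw [Fin.sum_univ_eq_sum_range (fun i => i) m, Finset.sum_range_id]
  have hmap : (IntermediateField.adjoin K (Set.range fun p : Fin m × Fin m => C p.1 p.2)).map j =
      IntermediateField.adjoin K (Set.range fun p : Fin m × Fin m => C' p.1 p.2) := by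
    rw [IntermediateField.adjoin_map, ← Set.range_comp]
    rfl
  have htr := (IntermediateField.equivMap
    (IntermediateField.adjoin K (Set.range fun p : Fin m × Fin m => C p.1 p.2)) j).trdeg_eq
  rw [htr, hmap]
  refine (trdeg_adjoin_le_mk (Set.range S₀) _ ?_).trans hcard
  rintro _ ⟨⟨p, q⟩, rfl⟩
  have hsqalg : ∀ x : K, IsAlgebraic E (sq x) := by
    intro x
    refine IsAlgebraic.of_pow two_pos ?_
    rw [hsq, IsScalarTower.algebraMap_apply K E Ω]
    exact isAlgebraic_algebraMap _
  have hval : C' p q = (β p)⁻¹ * ((if p ∈ s then -1 else 1) * g p q) * α q := by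
    have h1 : O p q = (if p ∈ s then -1 else 1) * g p q := by
      have : O = signDiag Ω s * g := by rw [hg, ← mul_assoc, hEE, one_mul]
      rw [this, signDiag, Matrix.diagonal_mul]
    rw [← h1]
    simp only [O, Matrix.mul_diagonal, Matrix.diagonal_mul]
    have h1 := hα0 q
    have h2 := hβ0 p
    rw [mul_assoc, mul_assoc _ (α q)⁻¹, inv_mul_cancel₀ h1, mul_one, inv_mul_cancel_left₀ h2]
  simp only [hval]
  refine ((hsqalg _).inv.mul (IsAlgebraic.mul ?_ ?_)).mul (hsqalg _)
  · split_ifs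
    · exact isAlgebraic_one.neg
    · exact isAlgebraic_one
  · exact isAlgebraic_algebraMap (⟨_, hgE p q⟩ : E)

/-! ### From an isotropic subspace to an orthonormal basis -/

section Isotropic

variable {F : Type*} [Field F] {ι : Type*} [Fintype ι]

/-- The left inverse shows that the rows of `Z` span, so m of them form a basis; `e` places those
first. This selects a chart of the Grassmannian around the column space of `Z`. -/
theorem exists_equiv_isUnit_submatrix [DecidableEq ι] {m : ℕ} (hcard : Fintype.card ι = 2 * m)
    (Z : Matrix ι (Fin m) F) (P : Matrix (Fin m) ι F) (hPZ : P * Z = 1) :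
    ∃ e : Fin m ⊕ Fin m ≃ ι, IsUnit (Z.submatrix (fun a => e (Sum.inl a)) id) := by
  have htop : ⊤ ≤ Submodule.span F (Set.range fun i => Z i) := by
    rw [← (Pi.basisFun F (Fin m)).span_eq, Submodule.span_le]
    rintro _ ⟨a, rfl⟩
    have h1 : Pi.basisFun F (Fin m) a = ∑ i, P a i • Z i := by
      ext b
      have h2 := congrFun (congrFun hPZ a) b
      rw [Matrix.mul_apply] at h2
      rw [Finset.sum_apply]
      simp only [Pi.smul_apply, smul_eq_mul]
      rw [h2]
      simp [Matrix.one_apply, Pi.single_apply, eq_comm]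
    rw [h1]
    exact Submodule.sum_mem _ fun i _ => Submodule.smul_mem _ _ (Submodule.subset_span ⟨i, rfl⟩)
  let b := Module.Basis.ofSpan htop
  let eb := (Pi.basisFun F (Fin m)).indexEquiv b
  have hb : ∀ a, ∃ i, Z i = b (eb a) := fun a => Module.Basis.ofSpan_subset htop ⟨eb a, rfl⟩
  choose r hr using hb
  have hrinj : Function.Injective r := by
    intro a c h
    have h1 : b (eb a) = b (eb c) := by rw [← hr, ← hr, h]
    exact eb.injective (b.injective h1)
  have hc : Fintype.card (Fin m) = Fintype.card ((Set.range r)ᶜ : Set ι) := by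
    rw [Fintype.card_compl_set, Set.card_range_of_injective hrinj, hcard, Fintype.card_fin]
    omega
  let e2 : Fin m ≃ ((Set.range r)ᶜ : Set ι) := Fintype.equivOfCardEq hc
  refine ⟨((Equiv.ofInjective r hrinj).sumCongr e2).trans (Equiv.Set.sumCompl _), ?_⟩
  rw [← Matrix.linearIndependent_rows_iff_isUnit]
  have h1 : LinearIndependent F fun a => b (eb a) := b.linearIndependent.comp _ eb.injective
  convert h1 using 1
  ext a c
  simp [← hr, Matrix.row]

/-- A maximal isotropic subspace of the diagonal form `d`, given in a chart by the matrix `C`,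
yields a basis in which the form becomes the sum of squares. -/
theorem transpose_mul_diagonal_mul_of_isotropic [CharZero F] {m : ℕ} {c : F} (hc : c * c = -1)
    (C : Matrix (Fin m) (Fin m) F) (a b : Fin m → F) (ha : ∀ i, a i ≠ 0)
    (hC : Matrix.diagonal a + Cᵀ * Matrix.diagonal b * C = 0) :
    let A : Matrix (Fin m) (Fin m) F := Matrix.diagonal fun i => 1 + (4 * a i)⁻¹
    let B : Matrix (Fin m) (Fin m) F := Matrix.diagonal fun i => 1 - (4 * a i)⁻¹
    let H := Matrix.fromBlocks A (c • B) (C * B) (c • (C * A))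
    Hᵀ * Matrix.fromBlocks (Matrix.diagonal a) 0 0 (Matrix.diagonal b) * H = 1 := by
  -- The vectors v_i = (e_i, Ce_i) and w_i = (e_i, -Ce_i) span two isotropic subspaces, and v_i
  -- pairs with w_j to 2a_i δ_ij. The columns of `H` are v_i + w_i/(4a_i), of norm 1, and c(v_i -
  -- w_i/(4a_i)), of norm -c² = 1.
  intro A B H
  have hAT : Aᵀ = A := Matrix.diagonal_transpose _
  have hBT : Bᵀ = B := Matrix.diagonal_transpose _
  have hC' : Cᵀ * (Matrix.diagonal b * C) = -Matrix.diagonal a := by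
    rw [← mul_assoc, eq_neg_iff_add_eq_zero, add_comm, hC]
  have hAB : A * Matrix.diagonal a * A - B * Matrix.diagonal a * B = 1 := by
    simp only [A, B, Matrix.diagonal_mul_diagonal, Matrix.diagonal_sub]
    rw [← Matrix.diagonal_one]
    congr 1
    ext i
    have := ha i
    field_simp
    ring
  have hcomm : A * Matrix.diagonal a * B = B * Matrix.diagonal a * A := by
    simp only [A, B, Matrix.diagonal_mul_diagonal]
    congr 1
    ext i
    ring
  have e1 : ∀ X Y : Matrix (Fin m) (Fin m) F,
      X * (Cᵀ * (Matrix.diagonal b * (C * Y))) = -(X * Matrix.diagonal a * Y) := by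
    intro X Y
    have : X * (Cᵀ * (Matrix.diagonal b * (C * Y))) = X * (Cᵀ * (Matrix.diagonal b * C)) * Y := by
      simp only [mul_assoc]
    rw [this, hC', Matrix.mul_neg, Matrix.neg_mul]
  simp only [H, Matrix.fromBlocks_transpose, Matrix.fromBlocks_multiply, Matrix.transpose_smul,
    Matrix.transpose_mul, hAT, hBT, Matrix.mul_zero, add_zero, zero_add, Matrix.smul_mul,
    Matrix.mul_smul, smul_smul, hc, mul_assoc, e1]
  rw [← Matrix.fromBlocks_one]
  congr 1
  · rw [← hAB, sub_eq_add_neg, mul_assoc, mul_assoc]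
  · rw [← mul_assoc, hcomm, ← smul_add, mul_assoc, add_neg_cancel, smul_zero]
  · rw [← mul_assoc B, ← hcomm, ← smul_add, mul_assoc, add_neg_cancel, smul_zero]
  · rw [← hAB]
    simp only [mul_assoc, neg_smul, one_smul]
    abel

end Isotropic

/-- The frame `φ` identifies the form `d` with a sum of squares, where the vectors e_p + √-1 e_{m+p}
span an isotropic subspace. Its preimage is the graph of a matrix `C`, and `E` is K(C); the
orthonormal basis built from `C` is `h`. -/
theorem exists_orthogonal_reduction {k : Type u} [Field k] [IsAlgClosed k] [CharZero k]
    {L : Type u} [Field L] [Algebra k L] (K : IntermediateField k L) {m : ℕ} {ι : Type*}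
    [Fintype ι] [DecidableEq ι] (hcard : Fintype.card ι = 2 * m) (φ : Matrix ι ι L) (d : ι → L)
    (hd : ∀ i, d i ∈ K) (hd0 : ∀ i, d i ≠ 0) (hφ : φᵀ * φ = Matrix.diagonal d) :
    ∃ (E : IntermediateField k L) (h : Matrix ι ι L), K ≤ E ∧
      Algebra.trdeg k E ≤ Algebra.trdeg k K + ((m * (m - 1) / 2 : ℕ) : Cardinal) ∧
      (∀ i j, h i j ∈ E) ∧ (φ * h)ᵀ * (φ * h) = 1 ∧ (φ * h).det = 1 := by
  have : CharZero L := charZero_of_injective_algebraMap (algebraMap k L).injective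
  obtain ⟨c₀, hc₀⟩ := IsAlgClosed.exists_pow_nat_eq (-1 : k) two_pos
  set c : L := algebraMap k L c₀ with hcdef
  have hc : c * c = -1 := by rw [hcdef, ← map_mul, ← sq, hc₀, map_neg, map_one]
  let e₀ : Fin m ⊕ Fin m ≃ ι := Fintype.equivOfCardEq (by
    rw [Fintype.card_sum, Fintype.card_fin, hcard]; omega)
  let W : Matrix ι (Fin m) L := (Matrix.fromRows 1 (c • 1)).submatrix e₀.symm id
  let P₀ : Matrix (Fin m) ι L := (Matrix.fromCols 1 0).submatrix id e₀.symm
  have hPW : P₀ * W = 1 := by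
    simp only [P₀, W]
    rw [Matrix.submatrix_mul_equiv, Matrix.fromCols_mul_fromRows]
    simp
  have hWW : Wᵀ * W = 0 := by
    simp only [W, Matrix.transpose_submatrix]
    rw [Matrix.submatrix_mul_equiv, Matrix.transpose_fromRows, Matrix.fromCols_mul_fromRows]
    simp [smul_smul, hc]
  have hdetφ : IsUnit φ.det := by
    have h1 := congrArg Matrix.det hφ
    rw [Matrix.det_mul, Matrix.det_diagonal] at h1
    have h2 : ∏ i, d i ≠ 0 := Finset.prod_ne_zero_iff.2 fun i _ => hd0 i
    exact isUnit_iff_ne_zero.2 (right_ne_zero_of_mul (h1.trans_ne h2))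
  let Z := φ⁻¹ * W
  have hφZ : φ * Z = W := by simp only [Z]; rw [Matrix.mul_nonsing_inv_cancel_left _ _ hdetφ]
  have hZZ : Zᵀ * Matrix.diagonal d * Z = 0 := by
    rw [← hφ, ← hWW, ← hφZ, Matrix.transpose_mul φ Z]
    simp only [Matrix.mul_assoc]
  obtain ⟨e, he⟩ := exists_equiv_isUnit_submatrix hcard Z (P₀ * φ)
    (by rw [Matrix.mul_assoc, hφZ, hPW])
  set X := Z.submatrix (fun a => e (Sum.inl a)) id with hX
  set Y := Z.submatrix (fun a => e (Sum.inr a)) id with hY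
  have hXdet : IsUnit X.det := (Matrix.isUnit_iff_isUnit_det _).1 he
  set C := Y * X⁻¹ with hCdef
  let a : Fin m → K := fun i => ⟨d (e (Sum.inl i)), hd _⟩
  let b : Fin m → K := fun i => ⟨d (e (Sum.inr i)), hd _⟩
  have hXY : Xᵀ * Matrix.diagonal (fun i => (a i : L)) * X +
      Yᵀ * Matrix.diagonal (fun i => (b i : L)) * Y = 0 := by
    rw [← hZZ]
    ext p q
    simp only [Matrix.add_apply, Matrix.mul_apply (M := _ * _), Matrix.mul_diagonal]
    rw [← Equiv.sum_comp e, Fintype.sum_sum_type]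
    rfl
  have hC : Matrix.diagonal (fun i => (a i : L)) +
      Cᵀ * Matrix.diagonal (fun i => (b i : L)) * C = 0 := by
    have h1 : Xᵀ * (Matrix.diagonal (fun i => (a i : L)) +
        Cᵀ * Matrix.diagonal (fun i => (b i : L)) * C) * X = 0 := by
      rw [← hXY]
      have h2 : C * X = Y := by rw [hCdef, Matrix.nonsing_inv_mul_cancel_right _ _ hXdet]
      have h3 : Xᵀ * Cᵀ = Yᵀ := by rw [← Matrix.transpose_mul, h2]
      rw [← h3]
      have h4 : ∀ N : Matrix (Fin m) (Fin m) L, N * Y = N * (C * X) := fun N => by rw [h2]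
      rw [h4]
      simp only [Matrix.mul_add, Matrix.add_mul, Matrix.mul_assoc]
    have hXT : IsUnit Xᵀ := (Matrix.isUnit_transpose _).2 he
    rw [mul_assoc] at h1
    exact (he.mul_left_eq_zero).1 ((hXT.mul_right_eq_zero).1 h1)
  let E₀ := IntermediateField.adjoin K (Set.range fun p : Fin m × Fin m => C p.1 p.2)
  have htr := trdeg_isotropic_chart_le C a b (fun i h => hd0 _ (congrArg Subtype.val h))
    (fun i h => hd0 _ (congrArg Subtype.val h)) hC
  let E : IntermediateField k L := E₀.restrictScalars k
  have hKE : K ≤ E := fun x hx => E₀.algebraMap_mem ⟨x, hx⟩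
  have hCE : ∀ p q, C p q ∈ E := fun p q => IntermediateField.subset_adjoin K _ ⟨(p, q), rfl⟩
  have hcE : c ∈ E := E.algebraMap_mem c₀
  have haE : ∀ p, (a p : L) ∈ E := fun p => hKE (a p).2
  have htrE : Algebra.trdeg k E ≤ Algebra.trdeg k K + ((m * (m - 1) / 2 : ℕ) : Cardinal) := by
    have h1 := trdeg_add_trdeg_restrictScalars K E₀
    exact h1.symm.le.trans (add_le_add le_rfl htr)
  have hH := transpose_mul_diagonal_mul_of_isotropic hc C (fun i => (a i : L)) (fun i => (b i : L))
    (fun i => hd0 _) hC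
  set A : Matrix (Fin m) (Fin m) L := Matrix.diagonal fun i => 1 + (4 * (a i : L))⁻¹ with hA
  set B : Matrix (Fin m) (Fin m) L := Matrix.diagonal fun i => 1 - (4 * (a i : L))⁻¹ with hB
  simp only at hH
  set H := Matrix.fromBlocks A (c • B) (C * B) (c • (C * A)) with hHdef
  have h4E : ∀ p, (4 * (a p : L))⁻¹ ∈ E := fun p =>
    inv_mem (mul_mem (by exact_mod_cast E.natCast_mem 4) (haE p))
  have hAE : ∀ p, 1 + (4 * (a p : L))⁻¹ ∈ E := fun p => add_mem (one_mem _) (h4E p)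
  have hBE : ∀ p, 1 - (4 * (a p : L))⁻¹ ∈ E := fun p => sub_mem (one_mem _) (h4E p)
  have hdiag : ∀ (x : Fin m → L), (∀ p, x p ∈ E) → ∀ p q, Matrix.diagonal x p q ∈ E := by
    intro x hx p q
    rw [Matrix.diagonal_apply]
    split_ifs
    · exact hx p
    · exact zero_mem _
  have hHE : ∀ p q, H p q ∈ E := by
    rintro (p | p) (q | q)
    · exact hdiag _ hAE p q
    · exact mul_mem hcE (hdiag _ hBE p q)
    · rw [hHdef, Matrix.fromBlocks_apply₂₁, hB, Matrix.mul_diagonal]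
      exact mul_mem (hCE _ _) (hBE _)
    · rw [hHdef, Matrix.fromBlocks_apply₂₂, Matrix.smul_apply, hA, Matrix.mul_diagonal]
      exact mul_mem hcE (mul_mem (hCE _ _) (hAE _))
  let h := H.submatrix e.symm e.symm
  have hdh : hᵀ * Matrix.diagonal d * h = 1 := by
    have h1 : Matrix.diagonal d = (Matrix.fromBlocks (Matrix.diagonal fun i => (a i : L)) 0 0
        (Matrix.diagonal fun i => (b i : L))).submatrix e.symm e.symm := by
      rw [Matrix.fromBlocks_diagonal, Matrix.submatrix_diagonal_equiv]
      congr 1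
      ext i
      obtain ⟨i, rfl⟩ := e.surjective i
      rcases i with i | i <;> simp [a, b]
    rw [h1]
    simp only [h, Matrix.transpose_submatrix]
    rw [Matrix.submatrix_mul_equiv, Matrix.submatrix_mul_equiv, hH, Matrix.submatrix_one_equiv]
  have horth : (φ * h)ᵀ * (φ * h) = 1 := by
    rw [← hdh, ← hφ, Matrix.transpose_mul]
    simp only [Matrix.mul_assoc]
  have hdet : (φ * h).det = 1 ∨ (φ * h).det = -1 := by
    have h1 := congrArg Matrix.det horth
    rw [Matrix.det_mul, Matrix.det_transpose, Matrix.det_one] at h1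
    exact mul_self_eq_one_iff.1 h1
  rcases hdet with hdet | hdet
  · exact ⟨E, h, hKE, htrE, fun i j => hHE _ _, horth, hdet⟩
  -- Determinant -1 is repaired by negating one column of `h`, which keeps it over `E`. A column
  -- exists because the empty determinant is 1.
  · have hne : Nonempty ι := by
      by_contra hemp
      rw [not_nonempty_iff] at hemp
      rw [Matrix.det_isEmpty] at hdet
      exact two_ne_zero (α := L) (by linear_combination hdet)
    obtain ⟨i₀⟩ := hne
    refine ⟨E, h * signDiag L {i₀}, hKE, htrE, ?_, ?_, ?_⟩
    · intro i j
      rw [signDiag, Matrix.mul_diagonal]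
      refine mul_mem (hHE _ _) ?_
      split_ifs
      · exact neg_mem (one_mem _)
      · exact one_mem _
    · rw [← Matrix.mul_assoc φ, Matrix.transpose_mul (φ * h), signDiag_transpose, Matrix.mul_assoc,
        ← Matrix.mul_assoc (φ * h)ᵀ, horth, Matrix.one_mul, signDiag_mul_self]
    · rw [← Matrix.mul_assoc, Matrix.det_mul, hdet, det_signDiag]
      simp

/-! ### Points of the group over reduced rings, and freeness -/

section Points

variable {n : ℕ}

/-- The equations expressing that a matrix lies in the special orthogonal group. -/
def soEquations {R : Type*} [CommRing R] (N : Matrix (Fin n) (Fin n) R) : Set R :=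
  insert (N.det - 1) (Set.range fun p : Fin n × Fin n => (N * Nᵀ - 1) p.1 p.2)

theorem forall_soEquations_iff {R T : Type*} [CommRing R] [CommRing T] (f : R →+* T)
    (N : Matrix (Fin n) (Fin n) R) : (∀ s ∈ soEquations N, f s = 0) ↔ IsSO (N.map f) := by
  have h1 : ∀ a b, f ((N * Nᵀ - 1) a b) = (N.map f * (N.map f)ᵀ - 1) a b := by
    intro a b
    have h := congrFun (congrFun (map_sub f.mapMatrix (N * Nᵀ) 1) a) b
    rw [map_mul, map_one] at h
    exact h
  have h2 : f N.det = (N.map f).det := f.map_det N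
  rw [soEquations, Set.forall_mem_insert, Set.forall_mem_range, IsSO, and_comm, map_sub, map_one,
    sub_eq_zero, h2, Prod.forall]
  simp only [h1]
  rw [← sub_eq_zero (a := N.map f * (N.map f)ᵀ), ← Matrix.ext_iff]
  rfl

variable {k : Type u} [Field k]

theorem mem_specialOrthogonal_iff (g : GL (Fin n) k) :
    g ∈ (specialOrthogonal k n).carrier ↔ IsSO g.1 := by
  change g.1 ∈ Matrix.specialOrthogonalGroup (Fin n) k ↔ _
  rw [Matrix.mem_specialOrthogonalGroup_iff, Matrix.mem_orthogonalGroup_iff]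
  rfl

theorem IsSO.transpose_mul_self {T : Type*} [CommRing T] {X : Matrix (Fin n) (Fin n) T}
    (h : IsSO X) : Xᵀ * X = 1 := mul_eq_one_comm.1 h.1

/-- The element of the group with the given matrix. -/
def toSpecialOrthogonal (X : Matrix (Fin n) (Fin n) k) (h : IsSO X) :
    (specialOrthogonal k n).carrier :=
  ⟨⟨X, Xᵀ, h.1, h.transpose_mul_self⟩, (mem_specialOrthogonal_iff _).2 h⟩

theorem isSO_coe (g : (specialOrthogonal k n).carrier) : IsSO g.1.1 :=
  (mem_specialOrthogonal_iff _).1 g.2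

variable [IsAlgClosed k]

theorem aeval_eq_zero_of_isSO (p : MvPolynomial (Fin n × Fin n) k)
    (hp : ∀ g : Matrix (Fin n) (Fin n) k, IsSO g →
      MvPolynomial.eval (fun ij => g ij.1 ij.2) p = 0)
    {T : Type*} [CommRing T] [Algebra k T] [IsReduced T] {X : Matrix (Fin n) (Fin n) T}
    (hX : IsSO X) : MvPolynomial.aeval (fun ij => X ij.1 ij.2) p = 0 := by
  let N : Matrix (Fin n) (Fin n) (MvPolynomial (Fin n × Fin n) k) :=
    Matrix.of fun i j => MvPolynomial.X (i, j)
  refine aeval_eq_zero_of_vanishes (soEquations N) p (fun z hz => ?_) _ ?_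
  · rw [forall_soEquations_iff] at hz
    convert! hp _ hz using 3
    ext ij
    simp [N]
  · have h1 := (forall_soEquations_iff
      (MvPolynomial.aeval (R := k) fun ij : Fin n × Fin n => X ij.1 ij.2).toRingHom N).2
    refine h1 ?_
    convert! hX using 1
    ext i j
    simp [N]

variable (V : (specialOrthogonal k n).Rep)

omit [IsAlgClosed k] in
theorem eval_num (g : (specialOrthogonal k n).carrier) (i j : Fin V.dim) :
    MvPolynomial.eval (fun ab => g.1.1 ab.1 ab.2) (V.num i j) = (V.hom g).1 i j := by
  rw [V.hom_apply, (isSO_coe g).2, one_pow, div_one]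

/-- Freeness as a polynomial identity: over `k`, if X and Y move ξ to the same vector and p(ξ) ≠ 0,
then Y⁻¹X fixes ξ, so X = Y. The Nullstellensatz in the variables X, Y, ξ carries this to `T`. -/
theorem eq_of_act_eq {p : MvPolynomial (Fin V.dim) k}
    (hp : ∀ x : Fin V.dim → k, MvPolynomial.eval x p ≠ 0 →
      ∀ g : (specialOrthogonal k n).carrier, (V.hom g).1 *ᵥ x = x → g = 1)
    {T : Type*} [CommRing T] [Algebra k T] [IsReduced T] {X Y : Matrix (Fin n) (Fin n) T}
    (hX : IsSO X) (hY : IsSO Y) (ξ : Fin V.dim → T)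
    (h : ∀ i, ∑ j, MvPolynomial.aeval (fun ab => X ab.1 ab.2) (V.num i j) * ξ j =
      ∑ j, MvPolynomial.aeval (fun ab => Y ab.1 ab.2) (V.num i j) * ξ j) (a b : Fin n) :
    MvPolynomial.aeval ξ p * (X a b - Y a b) = 0 := by
  let τ := (Fin n × Fin n) ⊕ (Fin n × Fin n) ⊕ Fin V.dim
  let iX : Fin n × Fin n → τ := Sum.inl
  let iY : Fin n × Fin n → τ := Sum.inr ∘ Sum.inl
  let iξ : Fin V.dim → τ := Sum.inr ∘ Sum.inr
  let NX : Matrix (Fin n) (Fin n) (MvPolynomial τ k) :=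
    Matrix.of fun i j => MvPolynomial.X (iX (i, j))
  let NY : Matrix (Fin n) (Fin n) (MvPolynomial τ k) :=
    Matrix.of fun i j => MvPolynomial.X (iY (i, j))
  let eqs : Fin V.dim → MvPolynomial τ k := fun i =>
    ∑ j, (MvPolynomial.rename iX (V.num i j) - MvPolynomial.rename iY (V.num i j)) *
      MvPolynomial.X (iξ j)
  let goal : MvPolynomial τ k := MvPolynomial.rename iξ p *
    (MvPolynomial.X (iX (a, b)) - MvPolynomial.X (iY (a, b)))
  have key := aeval_eq_zero_of_vanishes (soEquations NX ∪ soEquations NY ∪ Set.range eqs) goal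
    (T := T) ?_ (Sum.elim (fun ij => X ij.1 ij.2) (Sum.elim (fun ij => Y ij.1 ij.2) ξ)) ?_
  · simpa [goal, MvPolynomial.aeval_rename, iX, iY, iξ, Function.comp_def] using key
  · intro z hz
    have hzX : IsSO (NX.map (MvPolynomial.eval z)) :=
      (forall_soEquations_iff _ _).1 fun s hs => hz s (Or.inl (Or.inl hs))
    have hzY : IsSO (NY.map (MvPolynomial.eval z)) :=
      (forall_soEquations_iff _ _).1 fun s hs => hz s (Or.inl (Or.inr hs))
    set gX := toSpecialOrthogonal _ hzX with hgX
    set gY := toSpecialOrthogonal _ hzY with hgY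
    have hact : (V.hom gX).1 *ᵥ (z ∘ iξ) = (V.hom gY).1 *ᵥ (z ∘ iξ) := by
      ext i
      have h1 := hz (eqs i) (Or.inr ⟨i, rfl⟩)
      simp only [eqs, map_sum, map_mul, map_sub, MvPolynomial.eval_rename, MvPolynomial.eval_X,
        sub_mul, Finset.sum_sub_distrib, sub_eq_zero] at h1
      simp only [Matrix.mulVec, dotProduct, ← eval_num, Function.comp_apply]
      have hfX : (fun ab : Fin n × Fin n => gX.1.1 ab.1 ab.2) = z ∘ iX := by
        ext ij; simp [gX, toSpecialOrthogonal, NX]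
      have hfY : (fun ab : Fin n × Fin n => gY.1.1 ab.1 ab.2) = z ∘ iY := by
        ext ij; simp [gY, toSpecialOrthogonal, NY]
      rw [hfX, hfY]
      exact h1
    simp only [goal, map_mul, map_sub, MvPolynomial.eval_rename, MvPolynomial.eval_X]
    by_cases hpz : MvPolynomial.eval (z ∘ iξ) p = 0
    · rw [hpz, zero_mul]
    · have h1 : (V.hom (gY⁻¹ * gX)).1 *ᵥ (z ∘ iξ) = z ∘ iξ := by
        rw [map_mul, Units.val_mul, ← Matrix.mulVec_mulVec, hact, Matrix.mulVec_mulVec,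
          ← Units.val_mul, ← map_mul, inv_mul_cancel, map_one, Units.val_one, Matrix.one_mulVec]
      have h2 := inv_mul_eq_one.1 (hp _ hpz _ h1)
      have h3 : gX.1.1 a b = gY.1.1 a b := by rw [h2]
      have h4 : z (iX (a, b)) = z (iY (a, b)) := by
        simpa [gX, gY, toSpecialOrthogonal, NX, NY] using h3
      rw [h4, sub_self, mul_zero]
  · rintro s ((hs | hs) | ⟨i, rfl⟩)
    · refine (forall_soEquations_iff (MvPolynomial.aeval (R := k) (Sum.elim
        (fun ij : Fin n × Fin n => X ij.1 ij.2)
        (Sum.elim (fun ij : Fin n × Fin n => Y ij.1 ij.2) ξ))).toRingHom NX).2 ?_ s hs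
      convert! hX using 1
      ext i j
      simp [NX, iX]
    · refine (forall_soEquations_iff (MvPolynomial.aeval (R := k) (Sum.elim
        (fun ij : Fin n × Fin n => X ij.1 ij.2)
        (Sum.elim (fun ij : Fin n × Fin n => Y ij.1 ij.2) ξ))).toRingHom NY).2 ?_ s hs
      convert! hY using 1
      ext i j
      simp [NY, iY]
    · simp only [eqs, map_sum, map_mul, map_sub, MvPolynomial.aeval_rename, MvPolynomial.aeval_X,
        sub_mul, Finset.sum_sub_distrib, sub_eq_zero]
      exact h i

omit [IsAlgClosed k] in
theorem fieldAut_fieldAut (g h : (specialOrthogonal k n).carrier) (a : V.FunctionField) :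
    V.fieldAut h (V.fieldAut g a) = V.fieldAut (g * h) a := by
  have h1 : (V.fieldAut h : V.FunctionField →+* V.FunctionField).comp (V.fieldAut g) =
      (V.fieldAut (g * h) : V.FunctionField →+* V.FunctionField) := by
    apply IsLocalization.ringHom_ext (nonZeroDivisors (MvPolynomial (Fin V.dim) k))
    refine RingHom.ext fun p => ?_
    simp only [RingHom.comp_apply, RingHom.coe_coe, LinAlgGroup.Rep.fieldAut_algebraMap]
    rw [map_mul, Units.val_mul, ← LinAlgGroup.Rep.linSubst_comp]
    rfl
  exact DFunLike.congr_fun h1 a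

omit [IsAlgClosed k] in
theorem fieldAut_algebraMap_base (g : (specialOrthogonal k n).carrier) (c : k) :
    V.fieldAut g (algebraMap k V.FunctionField c) = algebraMap k V.FunctionField c :=
  V.invariantField.algebraMap_mem c g

omit [IsAlgClosed k] in
theorem fieldAut_coord (g : (specialOrthogonal k n).carrier) (i : Fin V.dim) :
    V.fieldAut g (V.coord i) =
      ∑ j, algebraMap k V.FunctionField ((V.hom g).1 i j) * V.coord j := by
  rw [LinAlgGroup.Rep.coord, LinAlgGroup.Rep.fieldAut_algebraMap, LinAlgGroup.Rep.linSubst,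
    MvPolynomial.aeval_X, map_sum]
  refine Finset.sum_congr rfl fun j _ => ?_
  rw [map_mul, IsScalarTower.algebraMap_apply k (MvPolynomial (Fin V.dim) k) V.FunctionField]
  rfl

end Points

/-! ### The generic torsor -/

section Torsor

variable {k : Type u} [Field k] [IsAlgClosed k] [CharZero k] {n : ℕ}
variable (V : (specialOrthogonal k n).Rep)

theorem aeval_algHom_comp_apply {R A B τ : Type*} [CommRing R] [CommRing A] [CommRing B]
    [Algebra R A] [Algebra R B] (f : A →ₐ[R] B) (x : τ → A) (p : MvPolynomial τ R) :
    MvPolynomial.aeval (fun i => f (x i)) p = f (MvPolynomial.aeval x p) := by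
  rw [← AlgHom.comp_apply, MvPolynomial.comp_aeval]

theorem IsSO.map {R T : Type*} [CommRing R] [CommRing T] {X : Matrix (Fin n) (Fin n) R}
    (h : IsSO X) (f : R →+* T) : IsSO (X.map f) := by
  refine (forall_soEquations_iff f X).1 fun s hs => ?_
  have h1 : IsSO (X.map (RingHom.id R)) := by simpa using h
  rw [show s = 0 from (forall_soEquations_iff _ X).2 h1 s hs, map_zero]

/-- The matrix entries, as functions on the group with values in the function field of `V`. -/
noncomputable def entryFun (a b : Fin n) : (specialOrthogonal k n).carrier → V.FunctionField :=
  fun g => algebraMap k V.FunctionField (g.1.1 a b)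

/-- The ring of regular functions on the group over the function field of `V`. -/
noncomputable def regularFun :
    Subalgebra V.FunctionField ((specialOrthogonal k n).carrier → V.FunctionField) :=
  Algebra.adjoin V.FunctionField (Set.range fun p : Fin n × Fin n => entryFun V p.1 p.2)

omit [IsAlgClosed k] [CharZero k] in
theorem aeval_entryFun_apply (p : MvPolynomial (Fin n × Fin n) V.FunctionField)
    (g : (specialOrthogonal k n).carrier) :
    MvPolynomial.aeval (fun ij => entryFun V ij.1 ij.2) p g = evalAt p g.1.1 := by
  have h := MvPolynomial.map_aeval (fun ij : Fin n × Fin n => entryFun V ij.1 ij.2)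
    (Pi.evalRingHom (fun _ => V.FunctionField) g) p
  rw [Pi.evalRingHom_apply] at h
  rw [h]
  rfl

/-- Irreducibility gives two nonzero regular functions over L a common `k`-point where neither
vanishes. -/
instance : IsDomain (regularFun V) := by
  have hnz : NoZeroDivisors (regularFun V) := by
    refine ⟨fun {a b} hab => ?_⟩
    obtain ⟨a, ha⟩ := a
    obtain ⟨b, hb⟩ := b
    rw [regularFun, Algebra.adjoin_range_eq_range_aeval] at ha hb
    obtain ⟨p, rfl⟩ := ha
    obtain ⟨q, rfl⟩ := hb
    by_contra! hne
    have h0 : ∀ r : MvPolynomial (Fin n × Fin n) V.FunctionField,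
        MvPolynomial.aeval (fun ij => entryFun V ij.1 ij.2) r ≠ 0 →
        ∃ g : Matrix (Fin n) (Fin n) k, IsSO g ∧ evalAt r g ≠ 0 := by
      intro r hr
      obtain ⟨g, hg⟩ := Function.ne_iff.1 hr
      rw [aeval_entryFun_apply] at hg
      exact ⟨g.1.1, isSO_coe g, hg⟩
    obtain ⟨g₀, hg₀, hp⟩ := h0 p fun h => hne.1 (Subtype.ext h)
    obtain ⟨g₁, hg₁, hq⟩ := h0 q fun h => hne.2 (Subtype.ext h)
    obtain ⟨g, hg, hpg, hqg⟩ := exists_common_nonvanishing p q hg₀ hg₁ hp hq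
    have h1 := congrFun (congrArg Subtype.val hab) (toSpecialOrthogonal g hg)
    have h2 : evalAt p g * evalAt q g = 0 := by
      rw [← show _ = evalAt p g from aeval_entryFun_apply V p (toSpecialOrthogonal g hg),
        ← show _ = evalAt q g from aeval_entryFun_apply V q (toSpecialOrthogonal g hg)]
      exact h1
    exact mul_ne_zero hpg hqg h2
  exact NoZeroDivisors.to_isDomain _

/-- The universal point of the group. -/
noncomputable def universalPoint : Matrix (Fin n) (Fin n) (regularFun V) :=
  Matrix.of fun a b => ⟨entryFun V a b, Algebra.subset_adjoin ⟨(a, b), rfl⟩⟩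

omit [IsAlgClosed k] [CharZero k] in
theorem isSO_universalPoint : IsSO (universalPoint V) := by
  have h1 : IsSO ((universalPoint V).map (RingHom.id (regularFun V))) := by
    rw [← forall_soEquations_iff]
    intro s hs
    refine Subtype.ext (funext fun g => ?_)
    have h2 : IsSO ((universalPoint V).map ((Pi.evalRingHom (fun _ => V.FunctionField) g).comp
        (regularFun V).val.toRingHom)) := (isSO_coe g).map (algebraMap k V.FunctionField)
    exact (forall_soEquations_iff _ _).2 h2 s hs
  simpa using h1

/-- The orbit map of the generic point of `V`. -/
noncomputable def orbitCoord (i : Fin V.dim) : regularFun V :=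
  ∑ j, MvPolynomial.aeval (fun ab => universalPoint V ab.1 ab.2) (V.num i j) *
    algebraMap V.FunctionField (regularFun V) (V.coord j)

omit [IsAlgClosed k] [CharZero k] in
theorem coe_orbitCoord (i : Fin V.dim) :
    (orbitCoord V i : (specialOrthogonal k n).carrier → V.FunctionField) =
      orb V.fieldAut (V.coord i) := by
  ext g
  rw [orb_apply, fieldAut_coord]
  let w : regularFun V →ₐ[k] V.FunctionField :=
    (((Pi.evalAlgHom V.FunctionField (fun _ => V.FunctionField) g).comp
      (regularFun V).val).restrictScalars k)
  change w (orbitCoord V i) = _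
  rw [orbitCoord, map_sum]
  refine Finset.sum_congr rfl fun j _ => ?_
  rw [map_mul, ← aeval_algHom_comp_apply, ← eval_num]
  congr 1
  have h1 := aeval_algHom_comp_apply (Algebra.ofId k V.FunctionField)
    (fun ab : Fin n × Fin n => g.1.1 ab.1 ab.2) (V.num i j)
  exact h1

-- `eq_of_act_eq` applies to the two images of the universal point acting on the generic vector; the
-- factor p(ξ) is a unit, being the image of a nonzero element of the field L.
omit [CharZero k] in
theorem universalPoint_eq_of_orbitCoord_eq (hV : V.IsGenericallyFree) {T : Type*} [CommRing T]
    [IsReduced T] (u v : regularFun V →+* T)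
    (huv : ∀ c, u (algebraMap V.FunctionField _ c) = v (algebraMap V.FunctionField _ c))
    (h : ∀ i, u (orbitCoord V i) = v (orbitCoord V i)) (a b : Fin n) :
    u (universalPoint V a b) = v (universalPoint V a b) := by
  obtain ⟨p, hp0, hp⟩ := hV
  let _ : Algebra k T := (u.comp (algebraMap k (regularFun V))).toAlgebra
  let u' : regularFun V →ₐ[k] T := { u with commutes' := fun _ => rfl }
  let v' : regularFun V →ₐ[k] T := { v with commutes' := fun c => (huv (algebraMap k _ c)).symm }
  have hso : ∀ w : regularFun V →ₐ[k] T, IsSO ((universalPoint V).map w) := by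
    intro w
    exact (isSO_universalPoint V).map w.toRingHom
  have hnum : ∀ (w : regularFun V →ₐ[k] T) i j,
      MvPolynomial.aeval (fun ab => (universalPoint V).map w ab.1 ab.2) (V.num i j) =
        w (MvPolynomial.aeval (fun ab => universalPoint V ab.1 ab.2) (V.num i j)) := by
    intro w i j
    rw [← aeval_algHom_comp_apply]
    rfl
  have key := eq_of_act_eq V hp (hso u') (hso v')
    (fun j => u' (algebraMap V.FunctionField _ (V.coord j))) ?_ a b
  · have hunit : IsUnit (MvPolynomial.aeval
        (fun j => u' (algebraMap V.FunctionField _ (V.coord j))) p) := by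
      let w : V.FunctionField →ₐ[k] T :=
        u'.comp (IsScalarTower.toAlgHom k V.FunctionField (regularFun V))
      have h1 : MvPolynomial.aeval (fun j => u' (algebraMap V.FunctionField _ (V.coord j))) p =
          w (algebraMap _ V.FunctionField p) := by
        have h2 := aeval_algHom_comp_apply w V.coord p
        have h3 : MvPolynomial.aeval V.coord p = algebraMap _ V.FunctionField p := by
          have h4 := aeval_algHom_comp_apply (IsScalarTower.toAlgHom k
            (MvPolynomial (Fin V.dim) k) V.FunctionField) MvPolynomial.X p
          rw [MvPolynomial.aeval_X_left_apply] at h4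
          exact h4
        rw [← h3, ← h2]
        rfl
      rw [h1]
      refine IsUnit.map w (isUnit_iff_ne_zero.2 ?_)
      rwa [Ne, IsFractionRing.to_map_eq_zero_iff]
    exact sub_eq_zero.1 ((hunit.mul_right_eq_zero).1 key)
  · intro i
    have h1 := h i
    simp only [orbitCoord, map_sum, map_mul] at h1
    simp only [hnum]
    refine h1.trans (Finset.sum_congr rfl fun j _ => ?_)
    rw [← huv]
    rfl

/-- Were a matrix entry outside the field `M` generated over L by the orbit coordinates, two maps to
a reduced ring agreeing on `M` would separate it, against freeness. -/
theorem exists_denominator (hV : V.IsGenericallyFree) (a b : Fin n) :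
    ∃ r s : MvPolynomial (Fin V.dim) V.FunctionField,
      MvPolynomial.aeval (orbitCoord V) s ≠ 0 ∧
      universalPoint V a b * MvPolynomial.aeval (orbitCoord V) s =
        MvPolynomial.aeval (orbitCoord V) r := by
  let F := FractionRing (regularFun V)
  let ι : regularFun V →ₐ[V.FunctionField] F := Algebra.ofId _ _ |>.restrictScalars _
  have hι : Function.Injective ι := IsFractionRing.injective (regularFun V) F
  let M := IntermediateField.adjoin V.FunctionField (Set.range fun i => ι (orbitCoord V i))
  have hmem : ι (universalPoint V a b) ∈ (algebraMap M F).range := by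
    by_contra hnot
    obtain ⟨T, _, _, u, v, huv, hne⟩ := exists_ringHom_ne_of_notMem_range hnot
    have hM : ∀ x : regularFun V, ι x ∈ M → u (ι x) = v (ι x) := fun x hx => huv ⟨ι x, hx⟩
    exact hne (universalPoint_eq_of_orbitCoord_eq V hV (u.comp ι.toRingHom) (v.comp ι.toRingHom)
      (fun c => hM _ (by rw [AlgHom.commutes]; exact M.algebraMap_mem c))
      (fun i => hM _ (IntermediateField.subset_adjoin _ _ ⟨i, rfl⟩)) a b)
  obtain ⟨⟨y, hy⟩, hyx⟩ := hmem
  rw [IntermediateField.mem_adjoin_range_iff] at hy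
  obtain ⟨r, s, hrs⟩ := hy
  have hae : ∀ t : MvPolynomial (Fin V.dim) V.FunctionField, MvPolynomial.aeval (fun i => ι (orbitCoord V i)) t =
      ι (MvPolynomial.aeval (orbitCoord V) t) := by
    intro t
    exact aeval_algHom_comp_apply ι (orbitCoord V) t
  rw [hae, hae] at hrs
  have hyx' : y = ι (universalPoint V a b) := hyx
  rw [hyx'] at hrs
  -- If the denominator vanishes, the convention x / 0 = 0 makes the entry itself zero, and 0 / 1
  -- represents it.
  by_cases hs : MvPolynomial.aeval (orbitCoord V) s = 0
  · rw [hs, map_zero, div_zero] at hrs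
    refine ⟨0, 1, by simp, ?_⟩
    rw [hι (hrs.trans (map_zero ι).symm)]
    simp
  · have hs' : ι (MvPolynomial.aeval (orbitCoord V) s) ≠ 0 := fun h0 =>
      hs (hι (h0.trans (map_zero ι).symm))
    have h1 := (eq_div_iff hs').1 hrs
    exact ⟨r, s, hs, hι ((map_mul ι _ _).trans h1)⟩

omit [IsAlgClosed k] [CharZero k] in
theorem span_range_orb_eq :
    Submodule.span V.FunctionField (Set.range (orb V.fieldAut)) =
      Subalgebra.toSubmodule (Algebra.adjoin V.FunctionField (Set.range (orb V.fieldAut))) := by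
  rw [Algebra.adjoin_eq_span]
  congr 1
  exact (congrArg SetLike.coe
    (Submonoid.closure_eq (MonoidHom.mrange (orb V.fieldAut).toMonoidHom))).symm

/-- The span of the `orb` functions is a ring `𝓜`. The conductor `J` of the matrix entries into `𝓜`
contains the product of all denominators and is stable under twists, so it contains some `orb x`
with x ≠ 0, which is a unit of `𝓜`. -/
theorem entryFun_mem_span (hV : V.IsGenericallyFree) (a b : Fin n) :
    entryFun V a b ∈ Submodule.span V.FunctionField (Set.range (orb V.fieldAut)) := by
  set 𝓜 := Algebra.adjoin V.FunctionField (Set.range (orb V.fieldAut)) with h𝓜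
  have hspan := span_range_orb_eq V
  have hσ := fieldAut_fieldAut V
  let J : Submodule V.FunctionField ((specialOrthogonal k n).carrier → V.FunctionField) :=
    { carrier := {c | c ∈ 𝓜 ∧ ∀ a b, c * entryFun V a b ∈ 𝓜}
      add_mem' := fun hc hd => ⟨add_mem hc.1 hd.1, fun a b => by
        rw [add_mul]; exact add_mem (hc.2 a b) (hd.2 a b)⟩
      zero_mem' := ⟨zero_mem _, fun a b => by rw [zero_mul]; exact zero_mem _⟩
      smul_mem' := fun x c hc => ⟨𝓜.smul_mem hc.1 x, fun a b => by
        rw [smul_mul_assoc]; exact 𝓜.smul_mem (hc.2 a b) x⟩ }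
  have hmem : ∀ c, c ∈ Submodule.span V.FunctionField (Set.range (orb V.fieldAut)) ↔ c ∈ 𝓜 := by
    intro c; rw [hspan]; rfl
  have htw : ∀ h c, c ∈ 𝓜 → twist V.fieldAut h c ∈ 𝓜 := fun h c hc =>
    (hmem _).1 (twist_mem_span _ hσ h ((hmem _).2 hc))
  have horb : ∀ t : MvPolynomial (Fin V.dim) V.FunctionField,
      (MvPolynomial.aeval (orbitCoord V) t : (specialOrthogonal k n).carrier → V.FunctionField) ∈
        𝓜 := by
    intro t
    have h1 : (MvPolynomial.aeval (orbitCoord V) t :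
        (specialOrthogonal k n).carrier → V.FunctionField) =
        MvPolynomial.aeval (fun i => orb V.fieldAut (V.coord i)) t := by
      have h2 := aeval_algHom_comp_apply (regularFun V).val (orbitCoord V) t
      refine h2.symm.trans ?_
      congr 2
      ext1 i
      exact coe_orbitCoord V i
    rw [h1, MvPolynomial.aeval_def]
    refine MvPolynomial.eval₂_mem (s := 𝓜) (fun d _ => ?_) fun i => Algebra.subset_adjoin ⟨_, rfl⟩
    exact 𝓜.algebraMap_mem _
  choose r s hs0 hrs using exists_denominator V hV
  let c : regularFun V := ∏ p : Fin n × Fin n, MvPolynomial.aeval (orbitCoord V) (s p.1 p.2)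
  have hc0 : c ≠ 0 := Finset.prod_ne_zero_iff.2 fun p _ => hs0 _ _
  have hcJ : (c : (specialOrthogonal k n).carrier → V.FunctionField) ∈ J := by
    refine ⟨?_, fun a b => ?_⟩
    · have : c = MvPolynomial.aeval (orbitCoord V) (∏ p : Fin n × Fin n, s p.1 p.2) := by
        rw [map_prod]
      rw [this]
      exact horb _
    · have : c * universalPoint V a b = MvPolynomial.aeval (orbitCoord V)
          ((∏ p ∈ Finset.univ.erase (a, b), s p.1 p.2) * r a b) := by
        rw [map_mul, ← hrs, map_prod, mul_left_comm,
          Finset.prod_erase_mul _ (fun p : Fin n × Fin n =>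
            MvPolynomial.aeval (orbitCoord V) (s p.1 p.2)) (Finset.mem_univ (a, b)), mul_comm]
      have h2 := congrArg Subtype.val this
      exact (show (c : (specialOrthogonal k n).carrier → V.FunctionField) * entryFun V a b = _
        from h2) ▸ horb _
  have hst : ∀ h, ∀ ψ ∈ J, twist V.fieldAut h ψ ∈ J := by
    rintro h ψ ⟨h1, h2⟩
    refine ⟨htw h ψ h1, fun a b => ?_⟩
    -- Right translation by h mixes the entries of a row linearly, with coefficients in `k`; this
    -- makes `J` stable.
    have h3 : twist V.fieldAut h⁻¹ (entryFun V a b) =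
        ∑ l, algebraMap k V.FunctionField (h.1.1 l b) • entryFun V a l := by
      ext g
      rw [twist_apply, inv_inv, entryFun, fieldAut_algebraMap_base, Finset.sum_apply]
      simp only [Subgroup.coe_mul, Units.val_mul, Matrix.mul_apply, map_sum, map_mul,
        Pi.smul_apply, smul_eq_mul, entryFun]
      exact Finset.sum_congr rfl fun _ _ => mul_comm _ _
    rw [← twist_twist_inv _ hσ h (entryFun V a b), ← map_mul, h3, Finset.mul_sum]
    refine htw _ _ (sum_mem fun l _ => ?_)
    rw [mul_smul_comm]
    exact 𝓜.smul_mem (h2 a l) _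
  obtain ⟨x, hx, hxJ⟩ := exists_orb_mem_of_twist_stable V.fieldAut hσ J
    (fun c hc => (hmem c).2 hc.1) hst hcJ (fun h => hc0 (Subtype.ext h))
  rw [hmem]
  have h1 : entryFun V a b = orb V.fieldAut x⁻¹ * (orb V.fieldAut x * entryFun V a b) := by
    rw [← mul_assoc, ← map_mul, inv_mul_cancel₀ hx, map_one, one_mul]
  rw [h1]
  exact mul_mem (Algebra.subset_adjoin ⟨_, rfl⟩) (hxJ.2 a b)

end Torsor

/-! ### The orthogonal frame and the canonical form map -/

theorem exists_congruent_diagonal {K : Type*} [Field K] [CharZero K] {n : ℕ}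
    (q : Matrix (Fin n) (Fin n) K) (hq : qᵀ = q) :
    ∃ (P : Matrix (Fin n) (Fin n) K) (d : Fin n → K), IsUnit P ∧ Pᵀ * q * P = Matrix.diagonal d := by
  have : Invertible (2 : K) := invertibleOfNonzero two_ne_zero
  have hsymm : LinearMap.IsSymm (Matrix.toBilin' q) := by
    refine ⟨fun x y => ?_⟩
    rw [RingHom.id_apply, Matrix.toBilin'_apply', Matrix.toBilin'_apply', Matrix.dotProduct_mulVec,
      dotProduct_comm, ← Matrix.mulVec_transpose, hq]
  obtain ⟨v₀, hv₀⟩ := LinearMap.BilinForm.exists_orthogonal_basis hsymm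
  let v := v₀.reindex (finCongr (Module.finrank_fin_fun K))
  have hv : ∀ i j, i ≠ j → v i ⬝ᵥ q *ᵥ v j = 0 := by
    intro i j hij
    have h1 := hv₀ (fun h => hij ((finCongr (Module.finrank_fin_fun K)).symm.injective h))
    simpa [v, Function.onFun, Matrix.toBilin'_apply'] using h1
  let P : Matrix (Fin n) (Fin n) K := Matrix.of fun i j => v j i
  refine ⟨P, fun i => v i ⬝ᵥ q *ᵥ v i, ?_, ?_⟩
  · rw [← Matrix.isUnit_transpose, ← Matrix.linearIndependent_rows_iff_isUnit]
    exact v.linearIndependent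
  · have h1 : ∀ i j, (Pᵀ * q * P) i j = v i ⬝ᵥ q *ᵥ v j := by
      intro i j
      rw [Matrix.mul_assoc, Matrix.mul_apply]
      rfl
    ext i j
    rw [h1]
    by_cases hij : i = j
    · subst hij; rw [Matrix.diagonal_apply_eq]
    · rw [Matrix.diagonal_apply_ne _ hij, hv i j hij]

section Final

variable {k : Type u} [Field k] [IsAlgClosed k] [CharZero k] {n : ℕ}
variable (V : (specialOrthogonal k n).Rep)

/-- Since g is orthogonal, the Gram matrix φφᵀ of the covariant matrix `φ` is invariant, so it can
be diagonalised over the invariant field. The base change multiplies φᵀ on the right by an invariant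
matrix and preserves covariance. -/
theorem exists_covariant_orthogonal_frame (hV : V.IsGenericallyFree) :
    ∃ (ψ : Matrix (Fin n) (Fin n) V.FunctionField) (d : Fin n → V.FunctionField), IsUnit ψ ∧
      (∀ g : (specialOrthogonal k n).carrier,
        ψ.map (V.fieldAut g) = g.1.1.map (algebraMap k V.FunctionField) * ψ) ∧
      (∀ i, d i ∈ V.invariantField) ∧ (∀ i, d i ≠ 0) ∧ ψᵀ * ψ = Matrix.diagonal d := by
  let ρ : (specialOrthogonal k n).carrier →* Matrix (Fin n) (Fin n) k :=
    (Units.coeHom _).comp (specialOrthogonal k n).carrier.subtype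
  obtain ⟨φ, hφ, hcov⟩ := exists_covariant_matrix V.fieldAut (fieldAut_fieldAut V) ρ
    (fieldAut_algebraMap_base V) (entryFun_mem_span V hV)
  have hinv : ∀ g, (ρ g⁻¹)ᵀ = ρ g := by
    intro g
    have h1 : ρ g * (ρ g)ᵀ = 1 := (isSO_coe g).1
    have h2 : ρ g⁻¹ * ρ g = 1 := by rw [← map_mul, inv_mul_cancel, map_one]
    have h3 : ρ g⁻¹ = (ρ g)ᵀ := left_inv_eq_right_inv h2 h1
    rw [h3, Matrix.transpose_transpose]
  have hcov' : ∀ g, φᵀ.map (V.fieldAut g) = (ρ g).map (algebraMap k V.FunctionField) * φᵀ := by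
    intro g
    rw [Matrix.transpose_map, hcov, Matrix.transpose_mul, ← Matrix.transpose_map, hinv]
  have hmul : ∀ g (A B : Matrix (Fin n) (Fin n) V.FunctionField),
      (A * B).map (V.fieldAut g) = A.map (V.fieldAut g) * B.map (V.fieldAut g) := fun g A B =>
    Matrix.map_mul (f := (V.fieldAut g : V.FunctionField →+* V.FunctionField))
  have horth : ∀ g, ((ρ g).map (algebraMap k V.FunctionField))ᵀ *
      (ρ g).map (algebraMap k V.FunctionField) = 1 := fun g =>
    ((isSO_coe g).map (algebraMap k V.FunctionField)).transpose_mul_self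
  have hgram : ∀ g, (φ * φᵀ).map (V.fieldAut g) = φ * φᵀ := by
    intro g
    have h1 : φ.map (V.fieldAut g) = φ * ((ρ g).map (algebraMap k V.FunctionField))ᵀ := by
      have h2 := congrArg Matrix.transpose (hcov' g)
      rw [Matrix.transpose_mul, Matrix.transpose_transpose] at h2
      exact h2
    rw [hmul, hcov', h1, Matrix.mul_assoc, ← Matrix.mul_assoc _ _ φᵀ, horth, Matrix.one_mul]
  let q : Matrix (Fin n) (Fin n) V.invariantField := Matrix.of fun i j =>
    ⟨(φ * φᵀ) i j, fun g => congrFun (congrFun (hgram g) i) j⟩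
  have hq : qᵀ = q := by
    ext i j
    change (φ * φᵀ)ᵀ i j = (φ * φᵀ) i j
    rw [Matrix.transpose_mul, Matrix.transpose_transpose]
  obtain ⟨P, d, hP, hPd⟩ := exists_congruent_diagonal q hq
  let val : V.invariantField →+* V.FunctionField := V.invariantField.val.toRingHom
  have hqmap : q.map val = φ * φᵀ := rfl
  have hPmap : ∀ g, (P.map val).map (V.fieldAut g) = P.map val := by
    intro g
    ext i j
    exact (P i j).2 g
  have hdiag : (φᵀ * P.map val)ᵀ * (φᵀ * P.map val) = Matrix.diagonal fun i => (d i : V.FunctionField) := by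
    have h1 := congrArg (fun M => M.map val) hPd
    simp only [Matrix.map_mul, hqmap] at h1
    rw [Matrix.diagonal_map (map_zero val)] at h1
    rw [Matrix.transpose_mul, Matrix.transpose_transpose]
    simp only [Matrix.mul_assoc] at h1 ⊢
    exact h1
  have hunit : IsUnit (φᵀ * P.map val) :=
    ((Matrix.isUnit_transpose _).2 hφ).mul (hP.map val.mapMatrix)
  refine ⟨φᵀ * P.map val, fun i => d i, hunit, ?_, fun i => (d i).2, ?_, hdiag⟩
  · intro g
    rw [hmul, hcov', hPmap, Matrix.mul_assoc]
    rfl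
  · have h1 : IsUnit (Matrix.diagonal fun i => (d i : V.FunctionField)) := by
      rw [← hdiag]
      exact ((Matrix.isUnit_transpose _).2 hunit).mul hunit
    rw [Matrix.isUnit_iff_isUnit_det, Matrix.det_diagonal, isUnit_iff_ne_zero,
      Finset.prod_ne_zero_iff] at h1
    exact fun i => h1 i (Finset.mem_univ i)

-- Density of the `k`-points in the `L`-points: split the coefficients of `Z` along a `k`-basis of
-- `L`; each component vanishes on `k`-points, hence at `f`.
omit [CharZero k] in
theorem eval_eq_zero_of_isSO {L : Type*} [Field L] [Algebra k L]
    (Z : MvPolynomial (Fin n × Fin n) L)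
    (hZ : ∀ g : Matrix (Fin n) (Fin n) k, IsSO g → evalAt Z g = 0)
    {f : Matrix (Fin n) (Fin n) L} (hf : IsSO f) :
    MvPolynomial.eval (fun ij => f ij.1 ij.2) Z = 0 := by
  classical
  let b := Module.Basis.ofVectorSpace k L
  let W := Z.support.biUnion fun α => (b.repr (Z.coeff α)).support
  let Zc : _ → MvPolynomial (Fin n × Fin n) k := fun t =>
    ∑ α ∈ Z.support, MvPolynomial.monomial α (b.coord t (Z.coeff α))
  have hzero : ∀ t, MvPolynomial.aeval (fun ij => f ij.1 ij.2) (Zc t) = 0 := by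
    intro t
    refine aeval_eq_zero_of_isSO (Zc t) (fun g hg => ?_) hf
    have h1 := congrArg (b.coord t) (hZ g hg)
    rw [evalAt, MvPolynomial.eval_eq', map_zero, map_sum] at h1
    rw [map_sum, ← h1]
    refine Finset.sum_congr rfl fun α _ => ?_
    rw [MvPolynomial.eval_monomial, Finsupp.prod_fintype _ _ (by simp)]
    simp only [← map_pow, ← map_prod]
    rw [mul_comm (Z.coeff α), ← Algebra.smul_def, map_smul, smul_eq_mul, mul_comm]
  have hcoeff : ∀ α ∈ Z.support, Z.coeff α =
      ∑ t ∈ W, algebraMap k L (b.coord t (Z.coeff α)) * b t := by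
    intro α hα
    have h1 := b.linearCombination_repr (Z.coeff α)
    rw [Finsupp.linearCombination_apply, Finsupp.sum_of_support_subset _
      (Finset.subset_biUnion_of_mem (fun α => (b.repr (Z.coeff α)).support) hα) _ (by simp)] at h1
    rw [← h1]
    refine Finset.sum_congr rfl fun t _ => ?_
    rw [h1, Algebra.smul_def]
    rfl
  rw [MvPolynomial.eval_eq']
  calc _ = ∑ α ∈ Z.support, ∑ t ∈ W, b t * (algebraMap k L (b.coord t (Z.coeff α)) *
        ∏ ij, f ij.1 ij.2 ^ α ij) := by
        refine Finset.sum_congr rfl fun α hα => ?_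
        conv_lhs => rw [hcoeff α hα]
        rw [Finset.sum_mul]
        exact Finset.sum_congr rfl fun t _ => by ring
    _ = ∑ t ∈ W, b t * MvPolynomial.aeval (fun ij => f ij.1 ij.2) (Zc t) := by
        rw [Finset.sum_comm]
        refine Finset.sum_congr rfl fun t _ => ?_
        rw [map_sum, Finset.mul_sum]
        refine Finset.sum_congr rfl fun α _ => ?_
        rw [MvPolynomial.aeval_monomial, Finsupp.prod_fintype _ _ (by simp)]
    _ = 0 := by simp [hzero]

-- Since g = σ_g(ψ)ψ⁻¹, the matrix entries, and with them the orbit coordinates, lie in the algebra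
-- generated over L by the `orb` functions of the entries of `ψ`. Descent of spans makes the
-- coefficients invariant.
omit [IsAlgClosed k] [CharZero k] in
theorem exists_coord_eq_polynomial {ψ : Matrix (Fin n) (Fin n) V.FunctionField} (hψ : IsUnit ψ)
    (hcov : ∀ g : (specialOrthogonal k n).carrier,
      ψ.map (V.fieldAut g) = g.1.1.map (algebraMap k V.FunctionField) * ψ) (i : Fin V.dim) :
    ∃ q : MvPolynomial (Fin n × Fin n) V.invariantField,
      ∀ g : (specialOrthogonal k n).carrier, V.fieldAut g (V.coord i) =
        MvPolynomial.aeval (fun ij =>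
          (g.1.1.map (algebraMap k V.FunctionField) * ψ) ij.1 ij.2) q := by
  set S : Set V.FunctionField := Set.range fun p : Fin n × Fin n => ψ p.1 p.2 with hS
  set A := Algebra.adjoin V.FunctionField (orb V.fieldAut '' S) with hA
  have hentry : ∀ a b, entryFun V a b ∈ A := by
    intro a b
    have h1 : entryFun V a b = ∑ l, (ψ⁻¹ l b) • orb V.fieldAut (ψ a l) := by
      ext g
      have h2 : ψ.map (V.fieldAut g) * ψ⁻¹ = g.1.1.map (algebraMap k V.FunctionField) := by
        rw [hcov, Matrix.mul_assoc, Matrix.mul_nonsing_inv _ ((Matrix.isUnit_iff_isUnit_det _).1 hψ),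
          Matrix.mul_one]
      have h3 := congrFun (congrFun h2 a) b
      rw [Matrix.mul_apply] at h3
      rw [Finset.sum_apply]
      exact h3.symm.trans (Finset.sum_congr rfl fun l _ => mul_comm _ _)
    rw [h1]
    exact sum_mem fun l _ => A.smul_mem (Algebra.subset_adjoin ⟨_, ⟨(a, l), rfl⟩, rfl⟩) _
  have hreg : regularFun V ≤ A := Algebra.adjoin_le (by rintro _ ⟨⟨a, b⟩, rfl⟩; exact hentry a b)
  have horb : orb V.fieldAut (V.coord i) ∈ A := by
    rw [← coe_orbitCoord]
    exact hreg (orbitCoord V i).2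
  have hspan : orb V.fieldAut (V.coord i) ∈ Submodule.span V.FunctionField
      (orb V.fieldAut '' (Submonoid.closure S : Set V.FunctionField)) := by
    have h1 : orb V.fieldAut '' (Submonoid.closure S : Set V.FunctionField) =
        (Submonoid.closure (orb V.fieldAut '' S) : Set _) :=
      congrArg SetLike.coe (MonoidHom.map_mclosure (orb V.fieldAut).toMonoidHom S)
    rw [h1]
    have h2 : orb V.fieldAut (V.coord i) ∈ Subalgebra.toSubmodule A := horb
    rwa [hA, Algebra.adjoin_eq_span] at h2
  have hK := mem_span_of_orb_mem_span V.fieldAut (fieldAut_fieldAut V) V.invariantField.toSubfield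
    (fun _ => Iff.rfl) _ _ hspan
  have hK' : V.coord i ∈ Algebra.adjoin V.invariantField S := by
    rw [← Subalgebra.mem_toSubmodule, Algebra.adjoin_eq_span]
    exact hK
  rw [hS, Algebra.adjoin_range_eq_range_aeval] at hK'
  obtain ⟨q, hq⟩ := hK'
  refine ⟨q, fun g => ?_⟩
  let τ : V.FunctionField →ₐ[V.invariantField] V.FunctionField :=
    { (V.fieldAut g : V.FunctionField →+* V.FunctionField) with commutes' := fun c => c.2 g }
  rw [← hq, ← hcov]
  exact (aeval_algHom_comp_apply τ (fun p : Fin n × Fin n => ψ p.1 p.2) q).symm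

-- Both sides are polynomials in the entries of `f`; by `hq` they agree at `k`-points of the group,
-- hence at its `L`-points.
omit [CharZero k] in
theorem canonicalForm_eq_polynomial {ψ : Matrix (Fin n) (Fin n) V.FunctionField}
    {f : Matrix (Fin n) (Fin n) V.FunctionField} (hf : IsSO f)
    {q : MvPolynomial (Fin n × Fin n) V.invariantField} {i : Fin V.dim}
    (hq : ∀ g : (specialOrthogonal k n).carrier, V.fieldAut g (V.coord i) =
        MvPolynomial.aeval (fun ij =>
          (g.1.1.map (algebraMap k V.FunctionField) * ψ) ij.1 ij.2) q) :
    ∑ j, MvPolynomial.aeval (fun ab => f ab.1 ab.2) (V.num i j) * V.coord j =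
      MvPolynomial.aeval (fun ij => (f * ψ) ij.1 ij.2) q := by
  let Z₁ : MvPolynomial (Fin n × Fin n) V.FunctionField :=
    ∑ j, (V.num i j).map (algebraMap k V.FunctionField) * MvPolynomial.C (V.coord j)
  let Z₂ : MvPolynomial (Fin n × Fin n) V.FunctionField := MvPolynomial.aeval
    (fun ij => ∑ l, MvPolynomial.X (ij.1, l) * MvPolynomial.C (ψ l ij.2)) q
  have h₁ : ∀ X : Matrix (Fin n) (Fin n) V.FunctionField,
      MvPolynomial.eval (fun ij => X ij.1 ij.2) Z₁ =
        ∑ j, MvPolynomial.aeval (fun ab => X ab.1 ab.2) (V.num i j) * V.coord j := by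
    intro X
    simp only [Z₁, map_sum, map_mul, MvPolynomial.eval_C, MvPolynomial.eval_map,
      MvPolynomial.aeval_def]
  have h₂ : ∀ X : Matrix (Fin n) (Fin n) V.FunctionField,
      MvPolynomial.eval (fun ij => X ij.1 ij.2) Z₂ =
        MvPolynomial.aeval (fun ij => (X * ψ) ij.1 ij.2) q := by
    intro X
    let τ : MvPolynomial (Fin n × Fin n) V.FunctionField →ₐ[V.invariantField] V.FunctionField :=
      (MvPolynomial.aeval (R := V.FunctionField) fun ij => X ij.1 ij.2).restrictScalars _
    have h3 := aeval_algHom_comp_apply τ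
      (fun ij => ∑ l, MvPolynomial.X (ij.1, l) * MvPolynomial.C (ψ l ij.2)) q
    refine Eq.trans ?_ (h3.symm.trans ?_)
    · rfl
    · congr 2
      ext ij
      simp [τ, Matrix.mul_apply]
  have key := eval_eq_zero_of_isSO (k := k) (Z₁ - Z₂) (fun g hg => ?_) hf
  · rw [map_sub, h₁, h₂, sub_eq_zero] at key
    exact key
  · have h3 := hq (toSpecialOrthogonal g hg)
    have h4 := h₁ (g.map (algebraMap k V.FunctionField))
    have h5 := h₂ (g.map (algebraMap k V.FunctionField))
    simp only [Matrix.map_apply] at h4 h5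
    rw [evalAt, map_sub, h4, h5, sub_eq_zero]
    refine Eq.trans ?_ h3
    rw [fieldAut_coord]
    refine Finset.sum_congr rfl fun j _ => ?_
    rw [← eval_num]
    congr 1
    exact aeval_algHom_comp_apply (Algebra.ofId k V.FunctionField)
      (fun ab : Fin n × Fin n => g ab.1 ab.2) (V.num i j)

end Final

/-! ### The bound -/

theorem aeval_mem_of_le {k L τ : Type*} [Field k] [Field L] [Algebra k L]
    {K E : IntermediateField k L} (hKE : K ≤ E) (q : MvPolynomial τ K) {x : τ → L}
    (hx : ∀ i, x i ∈ E) : MvPolynomial.aeval x q ∈ E := by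
  induction q using MvPolynomial.induction_on with
  | C a => rw [MvPolynomial.aeval_C]; exact hKE a.2
  | add p q hp hq => rw [map_add]; exact add_mem hp hq
  | mul_X p i hp => rw [map_mul, MvPolynomial.aeval_X]; exact mul_mem hp (hx i)

theorem canonicalDim_rep_le {k : Type u} [Field k] [IsAlgClosed k] [CharZero k] (m : ℕ)
    (V : (specialOrthogonal k (2 * m)).Rep) (hV : V.IsGenericallyFree) :
    V.canonicalDim ≤ ((m * (m - 1) / 2 : ℕ) : ℤ) := by
  obtain ⟨ψ, d, hψ, hcov, hdK, hd0, hψψ⟩ := exists_covariant_orthogonal_frame V hV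
  obtain ⟨E, h, hKE, htr, hhE, horth, hdet⟩ := exists_orthogonal_reduction V.invariantField
    (m := m) (by simp) ψ d hdK hd0 hψψ
  -- This is the inverse of ψh, and it takes the frame to fψ = hᵀ diag(d), which is defined over
  -- `E`.
  set f : Matrix (Fin (2 * m)) (Fin (2 * m)) V.FunctionField := (ψ * h)ᵀ with hf
  have hso : IsSO f := ⟨by rw [hf, Matrix.transpose_transpose, horth],
    by rw [hf, Matrix.det_transpose, hdet]⟩
  let F : GL (Fin (2 * m)) V.FunctionField := ⟨f, fᵀ, hso.1, hso.transpose_mul_self⟩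
  have hF : F ∈ (specialOrthogonal k (2 * m)).points V.FunctionField := by
    intro p hp
    exact aeval_eq_zero_of_isSO p
      (fun g hg => hp (toSpecialOrthogonal g hg).1 (toSpecialOrthogonal g hg).2) hso
  have hfψ : ∀ i j, (f * ψ) i j ∈ E := by
    intro i j
    rw [hf, Matrix.transpose_mul, Matrix.mul_assoc, hψψ, Matrix.mul_diagonal]
    exact mul_mem (hhE _ _) (hKE (hdK _))
  have hcoord : ∀ i, V.canonicalForm F i ∈ E := by
    intro i
    obtain ⟨q, hq⟩ := exists_coord_eq_polynomial V hψ hcov i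
    have h1 : V.canonicalForm F i = MvPolynomial.aeval (fun ij => (f * ψ) ij.1 ij.2) q := by
      rw [← canonicalForm_eq_polynomial V hso hq]
      change ∑ j, V.actionMatrix F i j * V.coord j = _
      refine Finset.sum_congr rfl fun j _ => ?_
      have hFd : F.1.det = 1 := hso.2
      rw [LinAlgGroup.Rep.actionMatrix, Matrix.of_apply, hFd, one_pow, div_one]
    rw [h1]
    exact aeval_mem_of_le hKE q fun ij => hfψ _ _
  have hle : IntermediateField.adjoin k (Set.range (V.canonicalForm F)) ≤ E :=
    IntermediateField.adjoin_le_iff.2 (by rintro _ ⟨i, rfl⟩; exact hcoord i)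
  have h1 : Algebra.trdeg k (IntermediateField.adjoin k (Set.range (V.canonicalForm F))) ≤
      Algebra.trdeg k V.invariantField + ((m * (m - 1) / 2 : ℕ) : Cardinal) :=
    (trdeg_le_of_injective (IntermediateField.inclusion hle)
      (IntermediateField.inclusion hle).injective).trans htr
  -- `Cardinal.toNat` sends infinite cardinals to 0, so the comparison needs a finite right-hand
  -- side.
  have hfin : Algebra.trdeg k V.invariantField < Cardinal.aleph0 := by
    refine (trdeg_le_of_injective V.invariantField.val V.invariantField.val.injective).trans_lt ?_
    have h2 : Algebra.trdeg k V.FunctionField ≤ Algebra.trdeg k (MvPolynomial (Fin V.dim) k) := by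
      have := IsLocalization.isAlgebraic V.FunctionField
        (nonZeroDivisors (MvPolynomial (Fin V.dim) k))
      have h3 := trdeg_add_eq k (MvPolynomial (Fin V.dim) k) (A := V.FunctionField)
      rw [← h3, trdeg_eq_zero (R := MvPolynomial (Fin V.dim) k), add_zero]
    exact h2.trans_lt trdeg_lt_aleph0_of_finiteType
  have h2 : V.dimImage (V.canonicalForm F) ≤ V.dimQuotient + m * (m - 1) / 2 := by
    have h3 := Cardinal.toNat_le_toNat h1
      (Cardinal.add_lt_aleph0 hfin Cardinal.natCast_lt_aleph0)
    rwa [Cardinal.toNat_add hfin Cardinal.natCast_lt_aleph0, Cardinal.toNat_natCast] at h3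
  -- The infimum over the integers is meaningful only for a set bounded below; -dim V/G is a bound
  -- since dim F(V) ≥ 0.
  have h3 : V.canonicalDim ≤ (V.dimImage (V.canonicalForm F) : ℤ) - V.dimQuotient :=
    csInf_le ⟨-(V.dimQuotient : ℤ), by rintro _ ⟨f, _, rfl⟩; omega⟩ ⟨F, hF, rfl⟩
  generalize m * (m - 1) / 2 = N at h2 ⊢
  omega

theorem mainTheorem11 {k : Type*} [Field k] [IsAlgClosed k] [CharZero k] (m : ℕ) (hm : 1 ≤ m) :
    (specialOrthogonal k (2 * m)).canonicalDim ≤ (((m : ℝ) * ((m : ℝ) - 1) / 2 : ℝ) : EReal) := by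
  refine iSup₂_le fun V hV => EReal.coe_le_coe_iff.2 ?_
  have h1 : ((V.canonicalDim : ℤ) : ℝ) ≤ ((m * (m - 1) / 2 : ℕ) : ℝ) := by
    exact (Int.cast_le.2 (canonicalDim_rep_le m V hV)).trans_eq (Int.cast_natCast _)
  -- Natural division only rounds down, so parity is not needed; `hm` makes the truncated m - 1 the
  -- true one.
  refine h1.trans (Nat.cast_div_le.trans ?_)
  rw [Nat.cast_mul, Nat.cast_sub hm]
  simp
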